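/- Let $(E,\mathcal E,m)$ and $(E_\partial,\mathcal E_\partial,m_\partial)$ be $\sigma$-finite measure spaces, and let $L^1=L^1(E,m)$ and $L^1_\partial=L^1(E_\partial,m_\partial)$ be the real $L^1$ spaces. A linear operator from a linear subspace of one of these spaces to one of these spaces is called positive if it maps nonnegative elements of its domain to nonnegative elements. A substochastic semigroup on $L^1$ is a $C_0$-semigroup of positive contractions on $L^1$. Let $\mathcal D\subseteq L^1$ be a linear subspace, let $A\colon\mathcal D\to L^1$ be a linear operator, and let $B\colon\mathcal D\to L^1$ and $\Psi_0,\Psi\colon\mathcal D\to L^1_\partial$ be positive linear operators. Assume: (i) the operator $A_0$, $A_0f=Af$ for $f\in\mathcal D(A_0)=\{f\in\mathcal D:\Psi_0f=0\}$, is the generator of a substochastic semigroup on $L^1$; (ii) if $\Psi_0\not\equiv0$, then for each $\lambda>0$ there is a positive linear operator $\Psi(\lambda)\colon L^1_\partial\to\mathrm{Ker}(\lambda-A)=\{f\in\mathcal D:\lambda f-Af=0\}$ such that $\Psi_0\Psi(\lambda)f_\partial=f_\partial$ for all $f_\partial\in L^1_\partial$ (if $\Psi_0\equiv0$, put $\Psi(\lambda)=0$);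 (iii) for each nonnegative $f\in\mathcal D$, $$\int_E(Af+Bf)\,dm+\int_{E_\partial}(\Psi f-\Psi_0f)\,dm_\partial\le0.$$ Let $A_\Psi f=Af$ for $f\in\mathcal D(A_\Psi)=\{f\in\mathcal D:\Psi_0f=\Psi f\}$. Then there exists a substochastic semigroup $\{P(t)\}_{t\ge0}$ on $L^1$ whose generator $(G,\mathcal D(G))$ is an extension of $(A_\Psi+B,\mathcal D(A_\Psi))$. Moreover, every $\lambda>0$ belongs to the resolvent sets of $A_0$ and of $G$, and the resolvent $R(\lambda,G)=(\lambda-G)^{-1}$ is given by $$R(\lambda,G)f=\lim_{N\to\infty}\sum_{n=0}^N\bigl(R(\lambda,A_0)B+\Psi(\lambda)\Psi\bigr)^nR(\lambda,A_0)f,\qquad f\in L^1,$$ with convergence in the norm of $L^1$, where $R(\lambda,A_0)=(\lambda-A_0)^{-1}$. -/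

import Mathlib

open MeasureTheory Filter Topology

namespace KatoGreiner

section Operators

variable {X : Type*} [NormedAddCommGroup X] [NormedSpace ℝ X]

/-- `G`, with its domain, is the infinitesimal generator of the family `(P t)_{t ≥ 0}`: the domain
is the set of all `f` for which `(P t f - f) / t` has a limit as `t ↓ 0`, and `G f` is that limit. -/
def IsGenerator (P : ℝ → X →L[ℝ] X) (G : X →ₗ.[ℝ] X) : Prop :=
  (∀ f : X, f ∈ G.domain ↔
    ∃ g : X, Tendsto (fun t : ℝ => t⁻¹ • (P t f - f)) (𝓝[>] 0) (𝓝 g)) ∧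
  ∀ f : G.domain, Tendsto (fun t : ℝ => t⁻¹ • (P t f - f)) (𝓝[>] 0) (𝓝 (G f))

/-- `lam` belongs to the resolvent set of `G` and `R = (lam - G)⁻¹`, seen as a map onto the domain
of `G`: it is a two-sided inverse of `lam - G`, and it is bounded as an operator on `X`. -/
def IsResolventAt (G : X →ₗ.[ℝ] X) (lam : ℝ) (R : X →ₗ[ℝ] G.domain) : Prop :=
  (∀ f : X, lam • (R f : X) - G (R f) = f) ∧
  (∀ f : G.domain, R (lam • (f : X) - G f) = f) ∧
  Continuous (fun f : X => (R f : X))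

/-- The operator `A : D → X` restricted to a subspace `S` of its domain `D`. -/
def restrictDomain {D : Submodule ℝ X} (A : D →ₗ[ℝ] X) (S : Submodule ℝ D) : X →ₗ.[ℝ] X :=
  (LinearPMap.mk D A).domRestrict (S.map D.subtype)

theorem restrictDomain_domain_le {D : Submodule ℝ X} (A : D →ₗ[ℝ] X) (S : Submodule ℝ D) :
    (restrictDomain A S).domain ≤ D :=
  LinearPMap.domRestrict_le.1

/-- The operator `R B + Q Ψ : D → D`, for `R` with values in a subspace `D₁` of `D`. -/
def stepOperator {Y : Type*} [AddCommGroup Y] [Module ℝ Y] {D D₁ : Submodule ℝ X} (h : D₁ ≤ D)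
    (R : X →ₗ[ℝ] D₁) (B : D →ₗ[ℝ] X) (Q : Y →ₗ[ℝ] D) (Ψ : D →ₗ[ℝ] Y) : Module.End ℝ D :=
  (Submodule.inclusion h ∘ₗ R) ∘ₗ B + Q ∘ₗ Ψ

end Operators

section L1

variable {E F : Type*} [MeasurableSpace E] [MeasurableSpace F]

/-- A linear operator from a subspace `D` of `L¹(m)` to `L¹(μ)` is positive if it maps the
nonnegative elements of `D` to nonnegative elements. -/
def IsPositiveOp {m : Measure E} {μ : Measure F} {D : Submodule ℝ (Lp ℝ 1 m)}
    (T : D →ₗ[ℝ] Lp ℝ 1 μ) : Prop :=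
  ∀ f : D, 0 ≤ (f : Lp ℝ 1 m) → 0 ≤ T f

/-- A `C₀`-semigroup of positive contractions on `L¹(m)`. Only the values `P t` with `t ≥ 0`
are part of the semigroup. -/
structure IsSubstochasticSemigroup {m : Measure E} (P : ℝ → Lp ℝ 1 m →L[ℝ] Lp ℝ 1 m) : Prop where
  zero : P 0 = ContinuousLinearMap.id ℝ (Lp ℝ 1 m)
  add : ∀ s t : ℝ, 0 ≤ s → 0 ≤ t → P (s + t) = (P s).comp (P t)
  continuousOn : ∀ f : Lp ℝ 1 m, ContinuousOn (fun t : ℝ => P t f) (Set.Ici 0)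
  positive : ∀ t : ℝ, 0 ≤ t → ∀ f : Lp ℝ 1 m, 0 ≤ f → 0 ≤ P t f
  contractive : ∀ t : ℝ, 0 ≤ t → ∀ f : Lp ℝ 1 m, 0 ≤ f → ‖P t f‖ ≤ ‖f‖

/-- `Q` is a positive right inverse of `Ψ₀` restricted to the nullspace of `lam - A`. -/
structure IsPositiveRightInverse {m : Measure E} {μ : Measure F} {D : Submodule ℝ (Lp ℝ 1 m)}
    (A : D →ₗ[ℝ] Lp ℝ 1 m) (Ψ₀ : D →ₗ[ℝ] Lp ℝ 1 μ) (lam : ℝ) (Q : Lp ℝ 1 μ →ₗ[ℝ] D) :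
    Prop where
  mem_ker : ∀ g : Lp ℝ 1 μ, lam • (Q g : Lp ℝ 1 m) - A (Q g) = 0
  positive : ∀ g : Lp ℝ 1 μ, 0 ≤ g → 0 ≤ (Q g : Lp ℝ 1 m)
  right_inv : ∀ g : Lp ℝ 1 μ, Ψ₀ (Q g) = g

end L1

end KatoGreiner

/-! Write R for the resolvent of A₀ at λ, Q for Ψ(λ) and K = RB + QΨ. The mass inequality bounds the
whole series. For f ≥ 0 let w be the sum of KⁿRf over n ≤ N, and u the same sum without its last
term. Then w = R(f + Bu) + QΨu, so λw - Aw = f + Bu and ∫Ψ₀w ≤ ∫Ψu. Inserting w in the mass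
inequality, with Bu ≤ Bw and Ψu ≤ Ψw, leaves λ∫w ≤ ∫f. Since the L¹ norm is additive on the positive
cone, the series converges absolutely to a positive operator T(λ) with ‖λT(λ)‖ ≤ 1
(`sum_norm_le_of_nonneg`, `exists_hasSum`).

The identity K_λ - K_μ = (μ - λ)R_λK_μ makes T a pseudo-resolvent, term by term along antidiagonals
(`pow_resolvent_sub`, `resolvent_identity`). That λT(λ) → 1 strongly is inherited from A₀, because
T(λ) dominates R (`norm_smul_sub_le`). The Hille–Yosida theorem (`exists_generator`), proved by
Yosida approximation so that positivity survives, then yields the semigroup and G.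

If Ψ₀f = Ψf and k = (λ - A - B)f, then f = Rk + Kf. Iterating, the partial sums for k are f - K^N f,
and K^N f → 0. So T(λ)k = f, which puts f in the domain of G with Gf = Af + Bf
(`tendsto_sum_of_boundary_eq`). -/

namespace KatoGreiner

/-! ### Contraction semigroups and their Laplace transforms. -/

section ContractionSemigroup

variable {X : Type*} [NormedAddCommGroup X] [NormedSpace ℝ X]

/-- A `C₀`-semigroup of contractions on a normed space. -/
structure IsContractionSemigroup (T : ℝ → X →L[ℝ] X) : Prop where
  zero : T 0 = ContinuousLinearMap.id ℝ X
  add : ∀ s t : ℝ, 0 ≤ s → 0 ≤ t → T (s + t) = (T s).comp (T t)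
  continuousOn : ∀ f : X, ContinuousOn (fun t : ℝ => T t f) (Set.Ici 0)
  norm_le : ∀ t : ℝ, 0 ≤ t → ∀ f : X, ‖T t f‖ ≤ ‖f‖

namespace IsContractionSemigroup

variable {T : ℝ → X →L[ℝ] X} (hT : IsContractionSemigroup T)

include hT

/-- The generator of a contraction semigroup is dissipative. -/
theorem mul_norm_le_of_tendsto {f g : X}
    (h : Tendsto (fun t : ℝ => t⁻¹ • (T t f - f)) (𝓝[>] 0) (𝓝 g)) (lam : ℝ) :
    lam * ‖f‖ ≤ ‖lam • f - g‖ := by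
  have h1 : Tendsto (fun t : ℝ => ‖lam • f - t⁻¹ • (T t f - f)‖) (𝓝[>] 0)
      (𝓝 ‖lam • f - g‖) := (tendsto_const_nhds.sub h).norm
  refine ge_of_tendsto h1 ?_
  filter_upwards [self_mem_nhdsWithin] with t (ht : 0 < t)
  have e : (lam + t⁻¹) • f = (lam • f - t⁻¹ • (T t f - f)) + t⁻¹ • T t f := by
    rw [add_smul, smul_sub]; abel
  have h2 : (lam + t⁻¹) * ‖f‖ ≤ ‖(lam + t⁻¹) • f‖ := by
    rw [norm_smul]
    exact mul_le_mul_of_nonneg_right (le_abs_self _) (norm_nonneg _)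
  have h3 : ‖t⁻¹ • T t f‖ ≤ t⁻¹ * ‖f‖ := by
    rw [norm_smul, Real.norm_of_nonneg (by positivity)]
    exact mul_le_mul_of_nonneg_left (hT.norm_le t ht.le f) (by positivity)
  have h4 := norm_add_le (lam • f - t⁻¹ • (T t f - f)) (t⁻¹ • T t f)
  rw [← e] at h4
  linarith

/-- If `lam f - G f = 0` with `lam > 0`, then `f = 0`. -/
theorem eq_zero_of_tendsto {f : X} {lam : ℝ} (hlam : 0 < lam)
    (h : Tendsto (fun t : ℝ => t⁻¹ • (T t f - f)) (𝓝[>] 0) (𝓝 (lam • f))) : f = 0 := by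
  have := hT.mul_norm_le_of_tendsto h lam
  rw [sub_self, norm_zero] at this
  exact norm_le_zero_iff.1 (nonpos_of_mul_nonpos_right this hlam)

/-- Nothing is known about `T t` for negative `t`; the truncation gives a function continuous on the
whole line. -/
theorem continuous_max (f : X) : Continuous fun t : ℝ => T (max t 0) f :=
  (hT.continuousOn f).comp_continuous (by fun_prop) fun t => le_max_right t 0

theorem integrableOn_exp_smul {lam : ℝ} (hlam : 0 < lam) (f : X) :
    IntegrableOn (fun t : ℝ => Real.exp (-lam * t) • T t f) (Set.Ioi 0) := by
  have h0 := (integrableOn_exp_mul_Ioi (neg_lt_zero.2 hlam) 0).mul_const ‖f‖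
  refine Integrable.mono' h0 ?_ ?_
  · refine ContinuousOn.aestronglyMeasurable ?_ measurableSet_Ioi
    exact (Continuous.continuousOn (by fun_prop)).smul
      ((hT.continuousOn f).mono Set.Ioi_subset_Ici_self)
  · refine (ae_restrict_mem measurableSet_Ioi).mono fun t (ht : 0 < t) => ?_
    rw [norm_smul, Real.norm_of_nonneg (Real.exp_pos _).le]
    exact mul_le_mul_of_nonneg_left (hT.norm_le t ht.le f) (Real.exp_pos _).le

omit hT in
/-- The Laplace transform `∫ exp (-lam t) T(t) f dt` of a semigroup. -/
noncomputable def laplace (T : ℝ → X →L[ℝ] X) (lam : ℝ) (f : X) : X :=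
  ∫ t in Set.Ioi (0 : ℝ), Real.exp (-lam * t) • T t f

theorem laplace_add {lam : ℝ} (hlam : 0 < lam) (f g : X) :
    laplace T lam (f + g) = laplace T lam f + laplace T lam g := by
  unfold laplace
  rw [← integral_add (hT.integrableOn_exp_smul hlam f) (hT.integrableOn_exp_smul hlam g)]
  simp only [map_add, smul_add]

omit hT in
theorem laplace_smul (lam c : ℝ) (f : X) : laplace T lam (c • f) = c • laplace T lam f := by
  unfold laplace
  rw [← integral_smul]
  refine integral_congr_ae (Eventually.of_forall fun t => ?_)
  simp only [map_smul, smul_comm c]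

theorem norm_laplace_le {lam : ℝ} (hlam : 0 < lam) (f : X) :
    ‖laplace T lam f‖ ≤ lam⁻¹ * ‖f‖ := by
  have h0 := (integrableOn_exp_mul_Ioi (neg_lt_zero.2 hlam) 0).mul_const ‖f‖
  refine (norm_integral_le_of_norm_le h0 ?_).trans_eq ?_
  · refine (ae_restrict_mem measurableSet_Ioi).mono fun t (ht : 0 < t) => ?_
    rw [norm_smul, Real.norm_of_nonneg (Real.exp_pos _).le]
    exact mul_le_mul_of_nonneg_left (hT.norm_le t ht.le f) (Real.exp_pos _).le
  · rw [integral_mul_const, integral_exp_mul_Ioi (neg_lt_zero.2 hlam)]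
    simp

/-- The substitution s = λt gives ∫ exp(-s) T(s/λ) f ds, where dominated convergence and continuity
at 0 apply. -/
theorem tendsto_smul_laplace [CompleteSpace X] (f : X) :
    Tendsto (fun lam : ℝ => lam • laplace T lam f) atTop (𝓝 f) := by
  have e : ∀ᶠ lam : ℝ in atTop, ∫ s in Set.Ioi (0 : ℝ), Real.exp (-s) • T (max (lam⁻¹ * s) 0) f
      = lam • laplace T lam f := by
    filter_upwards [eventually_gt_atTop 0] with lam hlam
    have := integral_comp_mul_left_Ioi
      (fun s : ℝ => Real.exp (-s) • T (max (lam⁻¹ * s) 0) f) 0 hlam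
    rw [mul_zero] at this
    rw [← smul_inv_smul₀ hlam.ne' (∫ s in Set.Ioi (0 : ℝ), _), ← this]
    congr 1
    refine setIntegral_congr_fun measurableSet_Ioi fun t (ht : 0 < t) => ?_
    rw [inv_mul_cancel_left₀ hlam.ne', max_eq_left ht.le, neg_mul]
  refine Tendsto.congr' e ?_
  have e2 : f = ∫ s in Set.Ioi (0 : ℝ), Real.exp (-s) • f := by
    rw [integral_smul_const, integral_exp_neg_Ioi_zero, one_smul]
  conv => rhs; rw [e2]
  refine tendsto_integral_filter_of_dominated_convergence (fun s => Real.exp (-s) * ‖f‖)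
    (Eventually.of_forall fun lam => ?_) (Eventually.of_forall fun lam => ?_)
    ((integrableOn_exp_neg_Ioi 0).mul_const _) (Eventually.of_forall fun s => ?_)
  · refine Continuous.aestronglyMeasurable ?_
    exact Continuous.smul (by fun_prop) ((hT.continuous_max f).comp (by fun_prop))
  · refine Eventually.of_forall fun s => ?_
    rw [norm_smul, Real.norm_of_nonneg (Real.exp_pos _).le]
    exact mul_le_mul_of_nonneg_left (hT.norm_le _ (le_max_right _ _) f) (Real.exp_pos _).le
  · refine Tendsto.const_smul ?_ _
    have h1 : Tendsto (fun lam : ℝ => lam⁻¹ * s) atTop (𝓝 0) := by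
      simpa using tendsto_inv_atTop_zero.mul_const s
    have h2 := ((hT.continuous_max f).tendsto 0).comp h1
    simpa [hT.zero, Function.comp_def] using h2

/-- The Laplace transform of a contraction semigroup takes values in the domain of its
generator `G`, and `G ∘ laplace = lam * laplace - id`. -/
theorem tendsto_laplace [CompleteSpace X] {lam : ℝ} (hlam : 0 < lam) (f : X) :
    Tendsto (fun t : ℝ => t⁻¹ • (T t (laplace T lam f) - laplace T lam f)) (𝓝[>] 0)
      (𝓝 (lam • laplace T lam f - f)) := by
  set L := laplace T lam f with hL
  set F : ℝ → X := fun t => Real.exp (-lam * t) • T (max t 0) f with hF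
  have hFc : Continuous F := Continuous.smul (by fun_prop) (hT.continuous_max f)
  have hFi : ∀ a : ℝ, 0 ≤ a → IntegrableOn F (Set.Ioi a) := fun a ha =>
    ((hT.integrableOn_exp_smul hlam f).congr_fun (fun t (ht : 0 < t) => by
      simp only [hF, max_eq_left ht.le]) measurableSet_Ioi).mono_set (Set.Ioi_subset_Ioi ha)
  have hLF : L = ∫ t in Set.Ioi (0 : ℝ), F t :=
    setIntegral_congr_fun measurableSet_Ioi fun t (ht : 0 < t) => by
      simp only [hF, max_eq_left ht.le]
  -- The semigroup law shifts the integral by `h`, so differentiating `T h L` at 0 reduces to the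
  -- fundamental theorem of calculus.
  have key : ∀ h : ℝ, 0 < h → T h L = Real.exp (lam * h) • (L - ∫ t in (0 : ℝ)..h, F t) := by
    intro h hh
    have e1 : L - ∫ t in (0 : ℝ)..h, F t = ∫ t in Set.Ioi h, F t := by
      rw [hLF, ← intervalIntegral.integral_interval_add_Ioi (hFi 0 le_rfl) (hFi h hh.le)]
      abel
    have e2 := (measurePreserving_add_right volume h).setIntegral_preimage_emb
      (measurableEmbedding_addRight h) F (Set.Ioi h)
    have e3 : (fun x => x + h) ⁻¹' Set.Ioi h = Set.Ioi (0 : ℝ) := by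
      ext x; simp
    rw [e1, ← e2, e3, ← integral_smul, hL, laplace,
      ← ContinuousLinearMap.integral_comp_comm _ (hT.integrableOn_exp_smul hlam f)]
    refine setIntegral_congr_fun measurableSet_Ioi fun t (ht : 0 < t) => ?_
    simp only [hF]
    rw [max_eq_left (by positivity), map_smul, smul_smul, ← Real.exp_add, add_comm t h,
      hT.add h t hh.le ht.le]
    congr 2
    ring
  have hd : HasDerivAt (fun h : ℝ => Real.exp (lam * h) • (L - ∫ t in (0 : ℝ)..h, F t))
      (lam • L - f) 0 := by
    have d1 : HasDerivAt (fun h : ℝ => Real.exp (lam * h)) lam 0 := by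
      simpa using ((hasDerivAt_id (0 : ℝ)).const_mul lam).exp
    have d2 : HasDerivAt (fun h : ℝ => L - ∫ t in (0 : ℝ)..h, F t) (-(F 0)) 0 :=
      (intervalIntegral.integral_hasDerivAt_right (hFc.intervalIntegrable _ _)
        (hFc.stronglyMeasurableAtFilter _ _) hFc.continuousAt).const_sub _
    have d3 := d1.smul d2
    have hF0 : F 0 = f := by simp [hF, hT.zero]
    simp only [hF0] at d3
    refine d3.congr_deriv ?_
    simp only [mul_zero, Real.exp_zero, one_smul, intervalIntegral.integral_same, sub_zero]
    abel
  have hs := hd.hasDerivWithinAt (s := Set.Ioi 0)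
  rw [hasDerivWithinAt_iff_tendsto_slope' (by simp)] at hs
  refine hs.congr' ?_
  filter_upwards [self_mem_nhdsWithin] with t (ht : 0 < t)
  rw [slope_def_module, key t ht]
  simp

end IsContractionSemigroup

end ContractionSemigroup

end KatoGreiner

/-! ### Exponentials of bounded operators. -/

namespace KatoGreiner

section Exponential

variable {X : Type*} [NormedAddCommGroup X] [NormedSpace ℝ X] [CompleteSpace X]

theorem exp_add_of_commute_real {a b : X →L[ℝ] X} (h : Commute a b) :
    NormedSpace.exp (a + b) = NormedSpace.exp a * NormedSpace.exp b :=
  NormedSpace.exp_add_of_commute_of_mem_ball (𝕂 := ℝ) h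
    ((NormedSpace.expSeries_radius_eq_top ℝ (X →L[ℝ] X)).symm ▸ edist_lt_top _ _)
    ((NormedSpace.expSeries_radius_eq_top ℝ (X →L[ℝ] X)).symm ▸ edist_lt_top _ _)

theorem hasDerivAt_exp_smul_apply (a : X →L[ℝ] X) (f : X) (t : ℝ) :
    HasDerivAt (fun s : ℝ => NormedSpace.exp (s • a) f) (NormedSpace.exp (t • a) (a f)) t :=
  (ContinuousLinearMap.apply ℝ X f).hasFDerivAt.comp_hasDerivAt t
    (hasDerivAt_exp_smul_const a t)

theorem hasSum_exp_apply (a : X →L[ℝ] X) (f : X) :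
    HasSum (fun n : ℕ => ((n.factorial : ℝ)⁻¹) • (a ^ n) f) (NormedSpace.exp a f) := by
  have h : HasSum (fun n : ℕ => ((n.factorial : ℝ)⁻¹) • a ^ n) (NormedSpace.exp a) :=
    NormedSpace.exp_series_hasSum_exp' a
  have h' := (ContinuousLinearMap.apply ℝ X f).hasSum h
  simpa only [ContinuousLinearMap.apply_apply, smul_apply] using h'

theorem norm_exp_apply_le {a : X →L[ℝ] X} {c : ℝ} (ha : ∀ f, ‖a f‖ ≤ c * ‖f‖) (hc : 0 ≤ c)
    (f : X) : ‖NormedSpace.exp a f‖ ≤ Real.exp c * ‖f‖ := by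
  have hpow : ∀ n : ℕ, ‖(a ^ n) f‖ ≤ c ^ n * ‖f‖ := by
    intro n
    induction n with
    | zero => simp
    | succ n ih =>
      rw [pow_succ', pow_succ', mul_apply_eq_comp, mul_assoc]
      exact (ha _).trans (mul_le_mul_of_nonneg_left ih hc)
  have hs : HasSum (fun n : ℕ => c ^ n / n.factorial * ‖f‖) (Real.exp c * ‖f‖) := by
    rw [Real.exp_eq_exp_ℝ]
    exact (NormedSpace.expSeries_div_hasSum_exp c).mul_right _
  rw [← (hasSum_exp_apply a f).tsum_eq]
  refine tsum_of_norm_bounded hs fun n => ?_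
  rw [norm_smul, Real.norm_of_nonneg (by positivity), div_eq_inv_mul, mul_assoc]
  exact mul_le_mul_of_nonneg_left (hpow n) (by positivity)

/-- The exponential of an operator leaving a closed convex cone invariant leaves it invariant. -/
theorem exp_apply_mem {C : Set X} (hC : IsClosed C) (h0 : (0 : X) ∈ C)
    (hadd : ∀ f ∈ C, ∀ g ∈ C, f + g ∈ C) (hsmul : ∀ c : ℝ, 0 ≤ c → ∀ f ∈ C, c • f ∈ C)
    {a : X →L[ℝ] X} (ha : ∀ f ∈ C, a f ∈ C) {f : X} (hf : f ∈ C) :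
    NormedSpace.exp a f ∈ C := by
  have hpow : ∀ n : ℕ, (a ^ n) f ∈ C := by
    intro n
    induction n with
    | zero => simpa using hf
    | succ n ih =>
      rw [pow_succ', mul_apply_eq_comp]
      exact ha _ ih
  refine hC.mem_of_tendsto (hasSum_exp_apply a f) (Eventually.of_forall fun s => ?_)
  exact Finset.sum_induction _ (· ∈ C) (fun x y hx hy => hadd x hx y hy) h0
    fun n _ => hsmul _ (by positivity) _ (hpow n)

theorem exp_add_smul_apply (a : X →L[ℝ] X) (s t : ℝ) (f : X) :
    NormedSpace.exp ((s + t) • a) f = NormedSpace.exp (s • a) (NormedSpace.exp (t • a) f) := by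
  rw [add_smul, exp_add_of_commute_real (((Commute.refl a).smul_left s).smul_right t)]
  rfl

theorem exp_add_smul_one_apply (a : X →L[ℝ] X) (c : ℝ) (f : X) :
    NormedSpace.exp (a + c • 1) f = Real.exp c • NormedSpace.exp a f := by
  have h := NormedSpace.algebraMap_exp_comm (𝕂 := ℝ) (𝔸 := X →L[ℝ] X) c
  rw [exp_add_of_commute_real ((Commute.one_right a).smul_right c), ← Algebra.algebraMap_eq_smul_one,
    ← h, ← Real.exp_eq_exp_ℝ, Algebra.algebraMap_eq_smul_one]
  simp

/-- Interpolate by s ↦ exp(sa) exp((t - s)b) f for s in [0, t]. Its derivative exp(sa) exp((t -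
s)b)(a - b)f has norm at most ‖(a - b)f‖. -/
theorem norm_exp_smul_sub_le {a b : X →L[ℝ] X} (hab : Commute a b)
    (ha : ∀ t : ℝ, 0 ≤ t → ∀ f, ‖NormedSpace.exp (t • a) f‖ ≤ ‖f‖)
    (hb : ∀ t : ℝ, 0 ≤ t → ∀ f, ‖NormedSpace.exp (t • b) f‖ ≤ ‖f‖) {t : ℝ} (ht : 0 ≤ t) (f : X) :
    ‖NormedSpace.exp (t • a) f - NormedSpace.exp (t • b) f‖ ≤ ‖a f - b f‖ * t := by
  have hd := fun s : ℝ => hasDerivAt_exp_smul_apply (a - b) (NormedSpace.exp (t • b) f) s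
  have hcb : Commute (a - b) (NormedSpace.exp (t • b)) := by
    have : Commute (a - b) (t • b) := (hab.sub_left (Commute.refl b)).smul_right t
    exact this.exp_right
  have hsplit : ∀ (s : ℝ) (g : X), NormedSpace.exp (s • (a - b)) (NormedSpace.exp (t • b) g)
      = NormedSpace.exp (s • a) (NormedSpace.exp ((t - s) • b) g) := by
    intro s g
    have c1 : Commute (s • (a - b)) (t • b) :=
      ((hab.sub_left (Commute.refl b)).smul_left s).smul_right t
    have c2 : Commute (s • a) ((t - s) • b) := (hab.smul_left s).smul_right _
    rw [← mul_apply_eq_comp, ← mul_apply_eq_comp,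
      ← exp_add_of_commute_real c1, ← exp_add_of_commute_real c2]
    congr 2
    module
  have hbound := norm_image_sub_le_of_norm_deriv_le_segment' (a := 0) (b := t)
    (C := ‖a f - b f‖) (fun s _ => (hd s).hasDerivWithinAt) ?_ t ⟨ht, le_rfl⟩
  · simpa [hsplit t f] using hbound
  · intro s hs
    have e : (a - b) (NormedSpace.exp (t • b) f) = NormedSpace.exp (t • b) ((a - b) f) :=
      congrArg (fun T : X →L[ℝ] X => T f) hcb.eq
    rw [e, hsplit]
    refine (ha s hs.1 _).trans ((hb _ (sub_nonneg.2 hs.2.le) _).trans ?_)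
    simp

theorem norm_exp_smul_sub_self_le {a : X →L[ℝ] X}
    (ha : ∀ t : ℝ, 0 ≤ t → ∀ f, ‖NormedSpace.exp (t • a) f‖ ≤ ‖f‖) {t : ℝ} (ht : 0 ≤ t) (f : X) :
    ‖NormedSpace.exp (t • a) f - f‖ ≤ ‖a f‖ * t := by
  simpa using norm_exp_smul_sub_le (Commute.zero_right a) ha (by simp) ht f

theorem norm_exp_smul_sub_sub_le (a : X →L[ℝ] X) (f : X) {C t : ℝ} (ht : 0 ≤ t)
    (h : ∀ s : ℝ, 0 ≤ s → s ≤ t → ‖NormedSpace.exp (s • a) (a f) - a f‖ ≤ C) :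
    ‖NormedSpace.exp (t • a) f - f - t • a f‖ ≤ C * t := by
  have hd : ∀ s : ℝ, HasDerivAt (fun s : ℝ => NormedSpace.exp (s • a) f - s • a f)
      (NormedSpace.exp (s • a) (a f) - a f) s := fun s =>
    ((hasDerivAt_exp_smul_apply a f s).sub ((hasDerivAt_id s).smul_const (a f))).congr_deriv
      (by simp)
  have hbound := norm_image_sub_le_of_norm_deriv_le_segment' (a := 0) (b := t) (C := C)
    (fun s _ => (hd s).hasDerivWithinAt) (fun s hs => h s hs.1 hs.2.le) t ⟨ht, le_rfl⟩
  have e : NormedSpace.exp (t • a) f - f - t • a f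
      = NormedSpace.exp (t • a) f - t • a f - f := by abel
  rw [e]
  simpa using hbound

end Exponential

end KatoGreiner

/-! ### The Hille–Yosida theorem for contractive pseudo-resolvents. -/

namespace KatoGreiner

section HilleYosida

variable {X : Type*} [NormedAddCommGroup X] [NormedSpace ℝ X]

/-- A pseudo-resolvent `(R lam)_{lam > 0}` with `‖lam R lam‖ ≤ 1` and `lam R lam → 1` strongly
as `lam → ∞`. -/
structure IsContractiveResolvent (R : ℝ → X →L[ℝ] X) : Prop where
  resolvent_eq : ∀ lam mu : ℝ, 0 < lam → 0 < mu → ∀ f,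
    R lam f - R mu f = (mu - lam) • R lam (R mu f)
  norm_le : ∀ lam : ℝ, 0 < lam → ∀ f, lam * ‖R lam f‖ ≤ ‖f‖
  tendsto : ∀ f, Tendsto (fun lam : ℝ => lam • R lam f) atTop (𝓝 f)

/-- The Yosida approximation `lam (lam R lam - 1)`. -/
noncomputable def yosida (R : ℝ → X →L[ℝ] X) (lam : ℝ) : X →L[ℝ] X :=
  lam • (lam • R lam - 1)

theorem yosida_apply (R : ℝ → X →L[ℝ] X) (lam : ℝ) (f : X) :
    yosida R lam f = lam • (lam • R lam f - f) := by
  simp [yosida]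

namespace IsContractiveResolvent

variable {R : ℝ → X →L[ℝ] X} (hR : IsContractiveResolvent R)

include hR

theorem commute {lam mu : ℝ} (hlam : 0 < lam) (hmu : 0 < mu) : Commute (R lam) (R mu) := by
  rcases eq_or_ne lam mu with rfl | hne
  · exact Commute.refl _
  · ext f
    have h1 := hR.resolvent_eq lam mu hlam hmu f
    have h2 := hR.resolvent_eq mu lam hmu hlam f
    have h3 : (mu - lam) • R lam (R mu f) = (mu - lam) • R mu (R lam f) := by
      rw [← h1, ← neg_sub (R mu f), h2, ← neg_smul, neg_sub]
    exact smul_right_injective X (sub_ne_zero.2 hne.symm) h3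

theorem commute_yosida {lam mu : ℝ} (hlam : 0 < lam) (hmu : 0 < mu) :
    Commute (yosida R lam) (yosida R mu) := by
  unfold yosida
  refine Commute.smul_left (Commute.smul_right ?_ _) _
  exact (Commute.sub_left (Commute.smul_left (Commute.sub_right
    (Commute.smul_right (hR.commute hlam hmu) _) (Commute.one_right _)) _) (Commute.one_left _))

/-- Each `R lam` has its range in that of `R 1`, so the generator can be built from `R 1` alone. -/
theorem eq_one {lam : ℝ} (hlam : 0 < lam) (f : X) :
    R lam f = R 1 (f - (lam - 1) • R lam f) := by
  rw [map_sub, map_smul, ← hR.resolvent_eq 1 lam one_pos hlam f]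
  abel

theorem exists_norm_sub_lt (f : X) {ε : ℝ} (hε : 0 < ε) : ∃ k, ‖f - R 1 k‖ < ε := by
  have h := (hR.tendsto f).eventually (Metric.ball_mem_nhds f hε)
  obtain ⟨lam, h1, hlam⟩ := (h.and (eventually_gt_atTop (0 : ℝ))).exists
  refine ⟨lam • (f - (lam - 1) • R lam f), ?_⟩
  rw [map_smul, ← hR.eq_one hlam, norm_sub_rev, ← dist_eq_norm]
  exact h1

theorem yosida_apply_one {lam : ℝ} (hlam : 0 < lam) (k : X) :
    yosida R lam (R 1 k) = lam • R lam (R 1 k - k) := by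
  have h := hR.resolvent_eq lam 1 hlam one_pos k
  rw [yosida_apply, map_sub]
  congr 1
  rw [sub_smul, one_smul] at h
  rw [← sub_eq_zero, ← sub_eq_zero.2 h]
  abel

/-- The limit is the value at `R 1 k` of the generator to be constructed, since (1 - G) `R 1 k`
should be `k`. -/
theorem tendsto_yosida (k : X) :
    Tendsto (fun lam : ℝ => yosida R lam (R 1 k)) atTop (𝓝 (R 1 k - k)) := by
  refine (hR.tendsto (R 1 k - k)).congr' ?_
  filter_upwards [eventually_gt_atTop (0 : ℝ)] with lam hlam
  rw [hR.yosida_apply_one hlam]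

variable [CompleteSpace X]

omit hR in
-- Splitting off the scalar part leaves the exponential of a nonnegative multiple of `R lam`;
-- contractivity and invariance of cones are both read off from this form.
theorem exp_yosida_apply (lam t : ℝ) (f : X) :
    NormedSpace.exp (t • yosida R lam) f
      = Real.exp (-(t * lam)) • NormedSpace.exp ((t * lam * lam) • R lam) f := by
  rw [← exp_add_smul_one_apply]
  congr 2
  unfold yosida
  module

theorem norm_exp_yosida_le {lam : ℝ} (hlam : 0 < lam) (t : ℝ) (ht : 0 ≤ t) (f : X) :
    ‖NormedSpace.exp (t • yosida R lam) f‖ ≤ ‖f‖ := by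
  rw [exp_yosida_apply, norm_smul, Real.norm_of_nonneg (Real.exp_pos _).le]
  have h : ∀ g, ‖((t * lam * lam) • R lam) g‖ ≤ (t * lam) * ‖g‖ := fun g => by
    rw [smul_apply, norm_smul, Real.norm_of_nonneg (by positivity), mul_assoc]
    exact mul_le_mul_of_nonneg_left (hR.norm_le lam hlam g) (by positivity)
  refine (mul_le_mul_of_nonneg_left (norm_exp_apply_le h (by positivity) f)
    (Real.exp_pos _).le).trans_eq ?_
  rw [← mul_assoc, ← Real.exp_add, neg_add_cancel, Real.exp_zero, one_mul]

theorem cauchySeq_exp_yosida {t : ℝ} (ht : 0 ≤ t) (f : X) :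
    CauchySeq fun n : ℕ => NormedSpace.exp (t • yosida R (n + 1)) f := by
  have hpos : ∀ n : ℕ, (0 : ℝ) < n + 1 := fun n => by positivity
  rw [Metric.cauchySeq_iff]
  intro ε hε
  obtain ⟨k, hk⟩ := hR.exists_norm_sub_lt f (show 0 < ε / 3 by positivity)
  have hc : CauchySeq fun n : ℕ => yosida R (n + 1) (R 1 k) :=
    ((hR.tendsto_yosida k).comp
      (tendsto_atTop_add_const_right _ 1 tendsto_natCast_atTop_atTop)).cauchySeq
  -- The factor `t + 1` in place of `t` covers `t = 0`.
  obtain ⟨N, hN⟩ := Metric.cauchySeq_iff.1 hc (ε / (3 * (t + 1))) (by positivity)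
  refine ⟨N, fun n hn p hp => ?_⟩
  have h1 := norm_exp_smul_sub_le (hR.commute_yosida (hpos n) (hpos p))
    (hR.norm_exp_yosida_le (hpos n)) (hR.norm_exp_yosida_le (hpos p)) ht (R 1 k)
  have h2 := hN n hn p hp
  rw [dist_eq_norm] at h2 ⊢
  have h3 := hR.norm_exp_yosida_le (hpos n) t ht (f - R 1 k)
  have h4 := hR.norm_exp_yosida_le (hpos p) t ht (f - R 1 k)
  have h5 : ‖yosida R (n + 1) (R 1 k) - yosida R (p + 1) (R 1 k)‖ * t ≤ ε / 3 := by
    refine (mul_le_mul h2.le (by linarith : t ≤ t + 1) ht (by positivity)).trans_eq ?_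
    field_simp
  have e : NormedSpace.exp (t • yosida R (n + 1)) f - NormedSpace.exp (t • yosida R (p + 1)) f
      = NormedSpace.exp (t • yosida R (n + 1)) (f - R 1 k)
        + (NormedSpace.exp (t • yosida R (n + 1)) (R 1 k)
          - NormedSpace.exp (t • yosida R (p + 1)) (R 1 k))
        - NormedSpace.exp (t • yosida R (p + 1)) (f - R 1 k) := by
    simp only [map_sub]; abel
  rw [e]
  refine (norm_sub_le _ _).trans_lt ?_
  have := norm_add_le (NormedSpace.exp (t • yosida R (n + 1)) (f - R 1 k))
    (NormedSpace.exp (t • yosida R (n + 1)) (R 1 k)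
          - NormedSpace.exp (t • yosida R (p + 1)) (R 1 k))
  linarith

theorem exists_limit_exp_yosida : ∃ P : ℝ → X →L[ℝ] X, ∀ t : ℝ, 0 ≤ t → ∀ f : X,
    Tendsto (fun n : ℕ => NormedSpace.exp (t • yosida R (n + 1)) f) atTop (𝓝 (P t f)) := by
  have h : ∀ t : ℝ, ∃ T : X →L[ℝ] X, 0 ≤ t → ∀ f : X,
      Tendsto (fun n : ℕ => NormedSpace.exp (t • yosida R (n + 1)) f) atTop (𝓝 (T f)) := by
    intro t
    by_cases ht : 0 ≤ t
    · choose F hF using fun f => cauchySeq_tendsto_of_complete (hR.cauchySeq_exp_yosida ht f)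
      exact ⟨continuousLinearMapOfTendsto (fun n : ℕ => NormedSpace.exp (t • yosida R (n + 1)))
        (tendsto_pi_nhds.2 hF), fun _ f => hF f⟩
    · exact ⟨0, fun h => absurd h ht⟩
  choose P hP using h
  exact ⟨P, hP⟩

section Limit

variable {P : ℝ → X →L[ℝ] X} (hP : ∀ t : ℝ, 0 ≤ t → ∀ f : X,
  Tendsto (fun n : ℕ => NormedSpace.exp (t • yosida R (n + 1)) f) atTop (𝓝 (P t f)))

include hP

theorem norm_limit_le {t : ℝ} (ht : 0 ≤ t) (f : X) : ‖P t f‖ ≤ ‖f‖ :=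
  le_of_tendsto' (hP t ht f).norm fun n => hR.norm_exp_yosida_le (by positivity) t ht f

omit hR [CompleteSpace X] in
theorem limit_zero : P 0 = ContinuousLinearMap.id ℝ X := by
  ext f
  refine tendsto_nhds_unique (hP 0 le_rfl f) ?_
  simp

theorem limit_add {s t : ℝ} (hs : 0 ≤ s) (ht : 0 ≤ t) : P (s + t) = (P s).comp (P t) := by
  ext f
  refine tendsto_nhds_unique (hP (s + t) (by positivity) f) ?_
  simp only [exp_add_smul_apply]
  have h1 : Tendsto (fun n : ℕ => NormedSpace.exp (s • yosida R (n + 1))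
      (NormedSpace.exp (t • yosida R (n + 1)) f - P t f)) atTop (𝓝 0) := by
    refine squeeze_zero_norm (fun n => hR.norm_exp_yosida_le (by positivity) s hs _) ?_
    exact tendsto_iff_norm_sub_tendsto_zero.1 (hP t ht f)
  have h2 := h1.add (hP s hs (P t f))
  simpa using h2

/-- The limit semigroup is Lipschitz at `0` on the range of the resolvent. -/
theorem norm_limit_sub_le (k : X) {t : ℝ} (ht : 0 ≤ t) :
    ‖P t (R 1 k) - R 1 k‖ ≤ ‖R 1 k - k‖ * t := by
  have hA : Tendsto (fun n : ℕ => yosida R (n + 1) (R 1 k)) atTop (𝓝 (R 1 k - k)) :=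
    (hR.tendsto_yosida k).comp
      (tendsto_atTop_add_const_right _ 1 tendsto_natCast_atTop_atTop)
  refine le_of_tendsto_of_tendsto' ((hP t ht (R 1 k)).sub_const (R 1 k)).norm
    (hA.norm.mul_const t) fun n => ?_
  exact norm_exp_smul_sub_self_le (hR.norm_exp_yosida_le (by positivity)) ht _

theorem isContractionSemigroup_limit : IsContractionSemigroup P where
  zero := limit_zero hP
  add s t hs ht := hR.limit_add hP hs ht
  norm_le t ht f := hR.norm_limit_le hP ht f
  continuousOn f := by
    have hadd : ∀ s t : ℝ, 0 ≤ s → s ≤ t → ∀ g, ‖P t g - P s g‖ ≤ ‖P (t - s) g - g‖ := by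
      intro s t hs hst g
      have h1 : P t g = P s (P (t - s) g) := by
        have := hR.limit_add hP hs (sub_nonneg.2 hst)
        rw [add_sub_cancel] at this
        rw [this]; rfl
      rw [h1, ← map_sub]
      exact hR.norm_limit_le hP hs _
    have hclose : ∀ k, ∀ t : ℝ, 0 ≤ t →
        ‖P t f - f‖ ≤ 2 * ‖f - R 1 k‖ + ‖R 1 k - k‖ * t := by
      intro k t ht
      have e : P t f - f = P t (f - R 1 k) + (P t (R 1 k) - R 1 k) - (f - R 1 k) := by
        rw [map_sub]; abel
      have h1 := hR.norm_limit_le hP ht (f - R 1 k)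
      have h2 := hR.norm_limit_sub_le hP k ht
      have h3 := norm_sub_le (P t (f - R 1 k) + (P t (R 1 k) - R 1 k)) (f - R 1 k)
      have h4 := norm_add_le (P t (f - R 1 k)) (P t (R 1 k) - R 1 k)
      rw [e]
      linarith
    rw [Metric.continuousOn_iff]
    intro s hs ε hε
    obtain ⟨k, hk⟩ := hR.exists_norm_sub_lt f (show 0 < ε / 4 by positivity)
    refine ⟨ε / (2 * (‖R 1 k - k‖ + 1)), by positivity, fun t ht hts => ?_⟩
    rw [Real.dist_eq] at hts
    have habs : ‖P t f - P s f‖ ≤ 2 * ‖f - R 1 k‖ + ‖R 1 k - k‖ * |t - s| := by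
      rcases le_total s t with hst | hst
      · rw [abs_of_nonneg (sub_nonneg.2 hst)]
        exact (hadd s t hs hst f).trans (hclose k _ (sub_nonneg.2 hst))
      · rw [abs_sub_comm, abs_of_nonneg (sub_nonneg.2 hst), norm_sub_rev]
        exact (hadd t s ht hst f).trans (hclose k _ (sub_nonneg.2 hst))
    have hle : ‖R 1 k - k‖ * |t - s| ≤ ε / 2 := by
      refine (mul_le_mul (by linarith : ‖R 1 k - k‖ ≤ ‖R 1 k - k‖ + 1) hts.le (abs_nonneg _)
        (by positivity)).trans_eq ?_
      field_simp
    rw [dist_eq_norm]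
    linarith

/-- The difference quotients of the limit semigroup converge on the range of the resolvent. -/
theorem tendsto_quotient_limit (k : X) :
    Tendsto (fun t : ℝ => t⁻¹ • (P t (R 1 k) - R 1 k)) (𝓝[>] 0) (𝓝 (R 1 k - k)) := by
  have hS := hR.isContractionSemigroup_limit hP
  set h := R 1 k - k with hh
  have hA : Tendsto (fun n : ℕ => yosida R (n + 1) (R 1 k)) atTop (𝓝 h) :=
    (hR.tendsto_yosida k).comp
      (tendsto_atTop_add_const_right _ 1 tendsto_natCast_atTop_atTop)
  -- The vector `h` need not lie in the range of `R 1`, where the orbits are known to be Lipschitz;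
  -- it is approximated by `R 1 j`, and the estimate for the Yosida approximations passes to the
  -- limit.
  have key : ∀ j, ∀ t : ℝ, 0 ≤ t →
      ‖P t (R 1 k) - R 1 k - t • h‖ ≤ (2 * ‖h - R 1 j‖ + ‖R 1 j - j‖ * t) * t := by
    intro j t ht
    have hAj : Tendsto (fun n : ℕ => yosida R (n + 1) (R 1 j)) atTop (𝓝 (R 1 j - j)) :=
      (hR.tendsto_yosida j).comp
        (tendsto_atTop_add_const_right _ 1 tendsto_natCast_atTop_atTop)
    have l1 := (((hP t ht (R 1 k)).sub_const (R 1 k)).sub (hA.const_smul t)).norm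
    have l2 := ((((hA.sub_const (R 1 j)).norm.const_mul 2)).add
      (hAj.norm.mul_const t)).mul_const t
    refine le_of_tendsto_of_tendsto' l1 l2 fun n => ?_
    have hc := hR.norm_exp_yosida_le (lam := (n : ℝ) + 1) (by positivity)
    refine norm_exp_smul_sub_sub_le _ _ ht fun s hs hst => ?_
    set a := yosida R ((n : ℝ) + 1) with ha
    set g := a (R 1 k) with hg
    have e : NormedSpace.exp (s • a) g - g = NormedSpace.exp (s • a) (g - R 1 j)
        + (NormedSpace.exp (s • a) (R 1 j) - R 1 j) - (g - R 1 j) := by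
      rw [map_sub]; abel
    have h1 := hc s hs (g - R 1 j)
    have h2 := norm_exp_smul_sub_self_le hc hs (R 1 j)
    have h3 := norm_sub_le (NormedSpace.exp (s • a) (g - R 1 j)
      + (NormedSpace.exp (s • a) (R 1 j) - R 1 j)) (g - R 1 j)
    have h4 := norm_add_le (NormedSpace.exp (s • a) (g - R 1 j))
      (NormedSpace.exp (s • a) (R 1 j) - R 1 j)
    have h5 : ‖a (R 1 j)‖ * s ≤ ‖a (R 1 j)‖ * t :=
      mul_le_mul_of_nonneg_left hst (norm_nonneg _)
    rw [e]
    linarith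
  rw [Metric.tendsto_nhdsWithin_nhds]
  intro ε hε
  obtain ⟨j, hj⟩ := hR.exists_norm_sub_lt h (show 0 < ε / 4 by positivity)
  refine ⟨ε / (2 * (‖R 1 j - j‖ + 1)), by positivity, fun t (ht : 0 < t) hts => ?_⟩
  rw [Real.dist_eq, sub_zero, abs_of_pos ht] at hts
  have e : t⁻¹ • (P t (R 1 k) - R 1 k) - h = t⁻¹ • (P t (R 1 k) - R 1 k - t • h) := by
    rw [smul_sub _ _ (t • h), inv_smul_smul₀ ht.ne']
  have hle : ‖R 1 j - j‖ * t ≤ ε / 2 := by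
    refine (mul_le_mul (by linarith : ‖R 1 j - j‖ ≤ ‖R 1 j - j‖ + 1) hts.le ht.le
      (by positivity)).trans_eq ?_
    field_simp
  rw [dist_eq_norm, e, norm_smul, Real.norm_of_nonneg (by positivity), inv_mul_lt_iff₀ ht,
    mul_comm]
  refine (key j t ht.le).trans_lt (mul_lt_mul_of_pos_right ?_ ht)
  linarith

end Limit

/-- The Hille–Yosida theorem: a contractive resolvent generates a contraction semigroup, which
leaves invariant each closed convex cone invariant under the resolvent. -/
theorem exists_semigroup : ∃ P : ℝ → X →L[ℝ] X, IsContractionSemigroup P ∧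
    (∀ f g : X, Tendsto (fun t : ℝ => t⁻¹ • (P t f - f)) (𝓝[>] 0) (𝓝 g) ↔ f = R 1 (f - g)) ∧
    ∀ C : Set X, IsClosed C → (0 : X) ∈ C → (∀ f ∈ C, ∀ g ∈ C, f + g ∈ C) →
      (∀ c : ℝ, 0 ≤ c → ∀ f ∈ C, c • f ∈ C) → (∀ lam : ℝ, 0 < lam → ∀ f ∈ C, R lam f ∈ C) →
      ∀ t : ℝ, 0 ≤ t → ∀ f ∈ C, P t f ∈ C := by
  obtain ⟨P, hP⟩ := hR.exists_limit_exp_yosida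
  have hS := hR.isContractionSemigroup_limit hP
  refine ⟨P, hS, fun f g => ⟨fun h => ?_, fun h => ?_⟩, ?_⟩
  -- The difference d = f - `R 1 (f - g)` is its own image under the generator, so it vanishes by
  -- dissipativity.
  · have h1 := h.sub (hR.tendsto_quotient_limit hP (f - g))
    have h2 : Tendsto (fun t : ℝ => t⁻¹ • (P t (f - R 1 (f - g)) - (f - R 1 (f - g)))) (𝓝[>] 0)
        (𝓝 ((1 : ℝ) • (f - R 1 (f - g)))) := by
      convert h1 using 1
      · ext t
        rw [map_sub, ← smul_sub]
        congr 1
        abel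
      · rw [one_smul]
        congr 1
        abel
    exact sub_eq_zero.1 (hS.eq_zero_of_tendsto one_pos h2)
  · have h1 := hR.tendsto_quotient_limit hP (f - g)
    rw [← h] at h1
    simpa using h1
  · intro C hC h0 hadd hsmul hRC t ht f hf
    refine hC.mem_of_tendsto (hP t ht f) (Eventually.of_forall fun n => ?_)
    rw [exp_yosida_apply]
    refine hsmul _ (Real.exp_pos _).le _ (exp_apply_mem hC h0 hadd hsmul (fun g hg => ?_) hf)
    exact hsmul _ (by positivity) _ (hRC _ (by positivity) g hg)

/-- Every contractive resolvent is the resolvent of the generator of a contraction semigroup. -/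
theorem exists_generator : ∃ (P : ℝ → X →L[ℝ] X) (G : X →ₗ.[ℝ] X), IsContractionSemigroup P ∧
    IsGenerator P G ∧
    (∀ C : Set X, IsClosed C → (0 : X) ∈ C → (∀ f ∈ C, ∀ g ∈ C, f + g ∈ C) →
      (∀ c : ℝ, 0 ≤ c → ∀ f ∈ C, c • f ∈ C) → (∀ lam : ℝ, 0 < lam → ∀ f ∈ C, R lam f ∈ C) →
      ∀ t : ℝ, 0 ≤ t → ∀ f ∈ C, P t f ∈ C) ∧
    (∀ lam : ℝ, 0 < lam → ∀ f g : X, f = R lam (lam • f - g) →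
      ∃ h : f ∈ G.domain, G ⟨f, h⟩ = g) ∧
    ∀ lam : ℝ, 0 < lam → ∃ R' : X →ₗ[ℝ] G.domain, IsResolventAt G lam R' ∧
      ∀ f, (R' f : X) = R lam f := by
  obtain ⟨P, hS, hG, hC⟩ := hR.exists_semigroup
  -- If `R 1 k = 0`, the pair (0, -k) lies in the graph of the generator, while the difference
  -- quotients of 0 vanish.
  have hinj : Function.Injective (R 1 : X →ₗ[ℝ] X) := by
    rw [injective_iff_map_eq_zero]
    intro k hk
    have hk' : R 1 k = 0 := hk
    have h := (hG 0 (-k)).2 (by simp [hk'])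
    simp only [map_zero, sub_zero, smul_zero] at h
    exact (neg_eq_zero.1 (tendsto_nhds_unique h tendsto_const_nhds))
  set e := LinearEquiv.ofInjective (R 1 : X →ₗ[ℝ] X) hinj with he
  let G : X →ₗ.[ℝ] X := ⟨LinearMap.range (R 1 : X →ₗ[ℝ] X),
    (LinearMap.range (R 1 : X →ₗ[ℝ] X)).subtype - e.symm.toLinearMap⟩
  have hGval : ∀ f : G.domain, (f : X) = R 1 (f - G f) := by
    intro f
    have h1 : G f = f - e.symm f := rfl
    rw [h1, sub_sub_cancel]
    exact (congrArg Subtype.val (e.apply_symm_apply f)).symm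
  have hGmem : ∀ f g : X, f = R 1 (f - g) → ∃ h : f ∈ G.domain, G ⟨f, h⟩ = g := by
    intro f g h
    have hf : f ∈ G.domain := ⟨f - g, h.symm⟩
    refine ⟨hf, ?_⟩
    have h2 : f - G ⟨f, hf⟩ = f - g := hinj ((hGval ⟨f, hf⟩).symm.trans h)
    exact sub_right_injective h2
  have hlamG : ∀ lam : ℝ, 0 < lam → ∀ f g : X, f = R lam (lam • f - g) →
      ∃ h : f ∈ G.domain, G ⟨f, h⟩ = g := by
    intro lam hlam f g h
    refine hGmem f g ?_
    have h1 := hR.eq_one hlam (lam • f - g)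
    rw [← h] at h1
    refine h1.trans (congrArg (R 1) ?_)
    module
  refine ⟨P, G, hS, ⟨fun f => ⟨fun hf => ⟨G ⟨f, hf⟩, (hG _ _).2 (hGval ⟨f, hf⟩)⟩, ?_⟩,
    fun f => (hG _ _).2 (hGval f)⟩, hC, hlamG, fun lam hlam => ?_⟩
  · rintro ⟨g, hg⟩
    exact (hGmem f g ((hG f g).1 hg)).1
  · have hres : ∀ u : X, ∃ h : R lam u ∈ G.domain, G ⟨R lam u, h⟩ = lam • R lam u - u :=
      fun u => hlamG lam hlam _ _ (by rw [sub_sub_cancel])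
    refine ⟨(R lam : X →ₗ[ℝ] X).codRestrict G.domain fun u => (hres u).1,
      ⟨fun u => ?_, fun f => ?_, (R lam).continuous⟩, fun f => rfl⟩
    · obtain ⟨h, hu⟩ := hres u
      have h3 : G ((R lam : X →ₗ[ℝ] X).codRestrict G.domain (fun u => (hres u).1) u)
        = lam • R lam u - u := hu
      rw [h3]
      exact sub_sub_cancel _ _
    · apply Subtype.ext
      have h1 := hR.resolvent_eq lam 1 hlam one_pos (f - G f)
      rw [← hGval f, sub_eq_iff_eq_add, ← map_smul] at h1
      have h2 : lam • (f : X) - G f = (f - G f) - (1 - lam) • (f : X) := by module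
      change R lam (lam • (f : X) - G f) = f
      rw [h2, map_sub, h1]
      abel

end IsContractiveResolvent

end HilleYosida

end KatoGreiner

/-! ### The integral as a functional on L¹, and positivity. -/

namespace KatoGreiner

section Mass

variable {E : Type*} [MeasurableSpace E] {m : Measure E}

theorem Lp_smul_nonneg {c : ℝ} (hc : 0 ≤ c) {f : Lp ℝ 1 m} (hf : 0 ≤ f) : 0 ≤ c • f := by
  rw [← Lp.coeFn_nonneg] at hf ⊢
  filter_upwards [hf, Lp.coeFn_smul c f] with x hx h
  rw [h]
  exact mul_nonneg hc hx

theorem isOrderedModule_Lp : IsOrderedModule ℝ (Lp ℝ 1 m) :=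
  IsOrderedModule.of_smul_nonneg fun _ hc _ hf => Lp_smul_nonneg hc hf

/-- The integral, as a function on `L¹`. -/
noncomputable def mass (f : Lp ℝ 1 m) : ℝ := ∫ x, f x ∂m

theorem mass_add (f g : Lp ℝ 1 m) : mass (f + g) = mass f + mass g := by
  unfold mass
  rw [← integral_add (L1.integrable_coeFn f) (L1.integrable_coeFn g)]
  exact integral_congr_ae (Lp.coeFn_add f g)

theorem mass_sub (f g : Lp ℝ 1 m) : mass (f - g) = mass f - mass g := by
  rw [eq_sub_iff_add_eq, ← mass_add, sub_add_cancel]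

theorem mass_zero : mass (0 : Lp ℝ 1 m) = 0 := by
  have := mass_sub (0 : Lp ℝ 1 m) 0
  rwa [sub_zero, sub_self] at this

theorem mass_smul (c : ℝ) (f : Lp ℝ 1 m) : mass (c • f) = c * mass f := by
  unfold mass
  rw [← integral_const_mul]
  exact integral_congr_ae (Lp.coeFn_smul c f)

theorem mass_sum {ι : Type*} (s : Finset ι) (f : ι → Lp ℝ 1 m) :
    mass (∑ i ∈ s, f i) = ∑ i ∈ s, mass (f i) := by
  classical
  induction s using Finset.induction_on with
  | empty => simp [mass_zero]
  | insert i s hi ih => rw [Finset.sum_insert hi, Finset.sum_insert hi, mass_add, ih]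

theorem mass_eq_norm {f : Lp ℝ 1 m} (hf : 0 ≤ f) : mass f = ‖f‖ := by
  rw [L1.norm_eq_integral_norm]
  refine integral_congr_ae ?_
  filter_upwards [(Lp.coeFn_nonneg f).2 hf] with x hx
  exact (Real.norm_of_nonneg hx).symm

theorem mass_nonneg {f : Lp ℝ 1 m} (hf : 0 ≤ f) : 0 ≤ mass f := by
  rw [mass_eq_norm hf]; exact norm_nonneg f

theorem mass_le_norm (f : Lp ℝ 1 m) : mass f ≤ ‖f‖ := by
  rw [L1.norm_eq_integral_norm]
  exact (Real.le_norm_self _).trans (norm_integral_le_integral_norm _)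

theorem norm_eq_posPart_add_negPart (f : Lp ℝ 1 m) : ‖f‖ = ‖f⁺‖ + ‖f⁻‖ := by
  rw [← mass_eq_norm (posPart_nonneg f), ← mass_eq_norm (negPart_nonneg f), ← mass_add,
    posPart_add_negPart, mass_eq_norm (abs_nonneg f), norm_abs_eq_norm]

/-- An additive function on `L¹` that is contractive on nonnegative elements is contractive. -/
theorem norm_map_le_of_nonneg {Z : Type*} [NormedAddCommGroup Z] (T : Lp ℝ 1 m →+ Z)
    (hT : ∀ f, 0 ≤ f → ‖T f‖ ≤ ‖f‖) (f : Lp ℝ 1 m) : ‖T f‖ ≤ ‖f‖ := by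
  rw [norm_eq_posPart_add_negPart f]
  conv_lhs => rw [← posPart_sub_negPart f, map_sub]
  exact (norm_sub_le _ _).trans (add_le_add (hT _ (posPart_nonneg f)) (hT _ (negPart_nonneg f)))

theorem IsSubstochasticSemigroup.isContractionSemigroup {P : ℝ → Lp ℝ 1 m →L[ℝ] Lp ℝ 1 m}
    (hP : IsSubstochasticSemigroup P) : IsContractionSemigroup P where
  zero := hP.zero
  add := hP.add
  continuousOn := hP.continuousOn
  norm_le t ht f := norm_map_le_of_nonneg (P t : Lp ℝ 1 m →+ Lp ℝ 1 m) (hP.contractive t ht) f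

theorem laplace_nonneg {P : ℝ → Lp ℝ 1 m →L[ℝ] Lp ℝ 1 m} (hP : IsSubstochasticSemigroup P)
    (lam : ℝ) {f : Lp ℝ 1 m} (hf : 0 ≤ f) : 0 ≤ IsContractionSemigroup.laplace P lam f := by
  have : IsOrderedModule ℝ (Lp ℝ 1 m) := isOrderedModule_Lp
  refine integral_nonneg_of_ae ((ae_restrict_mem measurableSet_Ioi).mono fun t (ht : 0 < t) => ?_)
  exact Lp_smul_nonneg (Real.exp_pos _).le (hP.positive t ht.le f hf)

end Mass

/-! ### The operator RB + QΨ: bounds on its powers and the resolvent identity. -/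

section Greiner

variable {E F : Type*} [MeasurableSpace E] [MeasurableSpace F]
  {m : Measure E} {μ : Measure F} {D : Submodule ℝ (Lp ℝ 1 m)}

/-- `R` is the positive resolvent at `lam` of the restriction of `A` to the kernel of `Ψ₀`, and
`Q` is a positive operator solving `lam f = A f` with boundary values `Ψ₀ f` prescribed. -/
structure IsGreinerResolvent (A : D →ₗ[ℝ] Lp ℝ 1 m) (Ψ₀ : D →ₗ[ℝ] Lp ℝ 1 μ) (lam : ℝ)
    (R : Lp ℝ 1 m →ₗ[ℝ] D) (Q : Lp ℝ 1 μ →ₗ[ℝ] D) : Prop where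
  sub_apply : ∀ f, lam • (R f : Lp ℝ 1 m) - A (R f) = f
  boundary : ∀ f, Ψ₀ (R f) = 0
  nonneg : ∀ f, 0 ≤ f → 0 ≤ (R f : Lp ℝ 1 m)
  left_inv : ∀ f : D, Ψ₀ f = 0 → R (lam • (f : Lp ℝ 1 m) - A f) = f
  mem_ker : ∀ g, lam • (Q g : Lp ℝ 1 m) - A (Q g) = 0
  lift_nonneg : ∀ g, 0 ≤ g → 0 ≤ (Q g : Lp ℝ 1 m)
  boundary_lift : ∀ f, Ψ₀ (Q (Ψ₀ f)) = Ψ₀ f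
  mass_boundary_lift : ∀ g, 0 ≤ g → mass (Ψ₀ (Q g)) ≤ mass g

/-- The operator `R B + Q Ψ` on `D`. -/
def greinerStep (R : Lp ℝ 1 m →ₗ[ℝ] D) (B : D →ₗ[ℝ] Lp ℝ 1 m) (Q : Lp ℝ 1 μ →ₗ[ℝ] D)
    (Ψ : D →ₗ[ℝ] Lp ℝ 1 μ) : Module.End ℝ D :=
  R ∘ₗ B + Q ∘ₗ Ψ

theorem greinerStep_apply (R : Lp ℝ 1 m →ₗ[ℝ] D) (B : D →ₗ[ℝ] Lp ℝ 1 m)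
    (Q : Lp ℝ 1 μ →ₗ[ℝ] D) (Ψ : D →ₗ[ℝ] Lp ℝ 1 μ) (f : D) :
    greinerStep R B Q Ψ f = R (B f) + Q (Ψ f) := rfl

theorem end_pow_succ_apply {M : Type*} [AddCommGroup M] [Module ℝ M] (T : Module.End ℝ M)
    (n : ℕ) (f : M) : (T ^ (n + 1)) f = T ((T ^ n) f) := by
  rw [pow_succ']; rfl

namespace IsGreinerResolvent

variable {A B : D →ₗ[ℝ] Lp ℝ 1 m} {Ψ₀ Ψ : D →ₗ[ℝ] Lp ℝ 1 μ} {lam mu : ℝ}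
  {R R' : Lp ℝ 1 m →ₗ[ℝ] D} {Q Q' : Lp ℝ 1 μ →ₗ[ℝ] D}

/-- Subtracting `Q (Ψ₀ f)` removes the boundary value without changing the image under `lam - A`. -/
theorem resolvent_add_lift (h : IsGreinerResolvent A Ψ₀ lam R Q) (f : D) :
    R (lam • (f : Lp ℝ 1 m) - A f) + Q (Ψ₀ f) = f := by
  have h1 := h.left_inv (f - Q (Ψ₀ f)) (by rw [map_sub, h.boundary_lift, sub_self])
  have h2 := h.mem_ker (Ψ₀ f)
  have h3 : lam • ((f - Q (Ψ₀ f) : D) : Lp ℝ 1 m) - A (f - Q (Ψ₀ f))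
      = lam • (f : Lp ℝ 1 m) - A f := by
    rw [map_sub, Submodule.coe_sub, smul_sub, sub_sub_sub_comm, h2, sub_zero]
  rw [← h3, h1, sub_add_cancel]

theorem pow_nonneg (h : IsGreinerResolvent A Ψ₀ lam R Q) (hB : IsPositiveOp B)
    (hΨ : IsPositiveOp Ψ) {f : D} (hf : 0 ≤ (f : Lp ℝ 1 m)) (n : ℕ) :
    0 ≤ (((greinerStep R B Q Ψ ^ n) f : D) : Lp ℝ 1 m) := by
  induction n with
  | zero => simpa using hf
  | succ n ih =>
    rw [end_pow_succ_apply, greinerStep_apply]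
    exact add_nonneg (h.nonneg _ (hB _ ih)) (h.lift_nonneg _ (hΨ _ ih))

section Bound

variable (h : IsGreinerResolvent A Ψ₀ lam R Q) (hB : IsPositiveOp B) (hΨ : IsPositiveOp Ψ)
  (hmass : ∀ f : D, 0 ≤ (f : Lp ℝ 1 m) → mass (A f + B f) + mass (Ψ f - Ψ₀ f) ≤ 0)

include h hB hΨ hmass

/-- The mass inequality is applied to the partial sum itself, not term by term. The boundary datum
`g` is needed later, to treat starting vectors outside the range of `R`. -/
theorem sum_norm_le_of_nonneg {f : Lp ℝ 1 m} (hf : 0 ≤ f) {g : Lp ℝ 1 μ} (hg : 0 ≤ g) (N : ℕ) :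
    lam * ∑ n ∈ Finset.range N, ‖(((greinerStep R B Q Ψ ^ n) (R f + Q g) : D) : Lp ℝ 1 m)‖
      ≤ ‖f‖ + ‖g‖ := by
  cases N with
  | zero => simpa using add_nonneg (norm_nonneg f) (norm_nonneg g)
  | succ N =>
  set K := greinerStep R B Q Ψ with hK
  have hv : 0 ≤ ((R f + Q g : D) : Lp ℝ 1 m) :=
    add_nonneg (h.nonneg f hf) (h.lift_nonneg g hg)
  have hpos := fun n => h.pow_nonneg hB hΨ hv n
  set u : D := ∑ n ∈ Finset.range N, (K ^ n) (R f + Q g) with hu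
  set w : D := ∑ n ∈ Finset.range (N + 1), (K ^ n) (R f + Q g) with hw
  have hu0 : 0 ≤ (u : Lp ℝ 1 m) := by
    rw [hu, Submodule.coe_sum]
    exact Finset.sum_nonneg fun n _ => hpos n
  have hw0 : 0 ≤ (w : Lp ℝ 1 m) := by
    rw [hw, Submodule.coe_sum]
    exact Finset.sum_nonneg fun n _ => hpos n
  have hwu : w = u + (K ^ N) (R f + Q g) := Finset.sum_range_succ _ _
  -- `w` has one term more than `u`, so it is one step of the iteration applied to `u`, plus the
  -- starting vector.
  have hwK : w = R (f + B u) + Q (g + Ψ u) := by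
    have e : w = K u + (R f + Q g) := by
      rw [hw, Finset.sum_range_succ', hu, map_sum]
      simp only [end_pow_succ_apply]
      rfl
    rw [e, hK, greinerStep_apply, map_add, map_add]
    abel
  have hAw : A w = lam • (w : Lp ℝ 1 m) - (f + B u) := by
    have h1 := h.sub_apply (f + B u)
    have h2 := h.mem_ker (g + Ψ u)
    rw [sub_eq_iff_eq_add] at h1 h2
    rw [hwK, map_add, Submodule.coe_add, smul_add, h1, h2]
    abel
  have hΨw : mass (Ψ₀ w) ≤ mass g + mass (Ψ u) := by
    rw [hwK, map_add, h.boundary, zero_add, ← mass_add]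
    exact h.mass_boundary_lift _ (add_nonneg hg (hΨ _ hu0))
  have hBw : mass (B u) ≤ mass (B w) := by
    rw [hwu, map_add, mass_add]
    linarith [mass_nonneg (hB _ (hpos N))]
  have hΨu : mass (Ψ u) ≤ mass (Ψ w) := by
    rw [hwu, map_add, mass_add]
    linarith [mass_nonneg (hΨ _ (hpos N))]
  have hm := hmass w hw0
  rw [mass_add, mass_sub, hAw, mass_sub, mass_smul, mass_add] at hm
  have hsum : mass (w : Lp ℝ 1 m)
      = ∑ n ∈ Finset.range (N + 1), ‖(((K ^ n) (R f + Q g) : D) : Lp ℝ 1 m)‖ := by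
    rw [hw, Submodule.coe_sum, mass_sum]
    exact Finset.sum_congr rfl fun n _ => mass_eq_norm (hpos n)
  rw [← hsum, ← mass_eq_norm hf, ← mass_eq_norm hg]
  linarith

theorem sum_norm_le (hlam : 0 ≤ lam) (f : Lp ℝ 1 m) (g : Lp ℝ 1 μ) (N : ℕ) :
    lam * ∑ n ∈ Finset.range N, ‖(((greinerStep R B Q Ψ ^ n) (R f + Q g) : D) : Lp ℝ 1 m)‖
      ≤ ‖f‖ + ‖g‖ := by
  have h1 := h.sum_norm_le_of_nonneg hB hΨ hmass (posPart_nonneg f) (posPart_nonneg g) N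
  have h2 := h.sum_norm_le_of_nonneg hB hΨ hmass (negPart_nonneg f) (negPart_nonneg g) N
  rw [norm_eq_posPart_add_negPart f, norm_eq_posPart_add_negPart g]
  set K := greinerStep R B Q Ψ with hK
  have e : R f + Q g = (R f⁺ + Q g⁺) - (R f⁻ + Q g⁻) := by
    conv_lhs => rw [← posPart_sub_negPart f, ← posPart_sub_negPart g, map_sub, map_sub]
    abel
  have h3 : ∑ n ∈ Finset.range N, ‖(((K ^ n) (R f + Q g) : D) : Lp ℝ 1 m)‖
      ≤ ∑ n ∈ Finset.range N, ‖(((K ^ n) (R f⁺ + Q g⁺) : D) : Lp ℝ 1 m)‖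
        + ∑ n ∈ Finset.range N, ‖(((K ^ n) (R f⁻ + Q g⁻) : D) : Lp ℝ 1 m)‖ := by
    rw [← Finset.sum_add_distrib]
    refine Finset.sum_le_sum fun n _ => ?_
    rw [e, map_sub, Submodule.coe_sub]
    exact norm_sub_le _ _
  have h4 := mul_le_mul_of_nonneg_left h3 hlam
  rw [mul_add] at h4
  linarith

theorem summable_norm (hlam : 0 < lam) (f : Lp ℝ 1 m) (g : Lp ℝ 1 μ) :
    Summable fun n : ℕ => ‖(((greinerStep R B Q Ψ ^ n) (R f + Q g) : D) : Lp ℝ 1 m)‖ := by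
  refine summable_of_sum_range_le (c := lam⁻¹ * (‖f‖ + ‖g‖)) (fun n => norm_nonneg _) fun N => ?_
  rw [← div_eq_inv_mul, le_div_iff₀' hlam]
  exact h.sum_norm_le hB hΨ hmass hlam.le f g N

theorem summable_norm_resolvent (hlam : 0 < lam) (f : Lp ℝ 1 m) :
    Summable fun n : ℕ => ‖(((greinerStep R B Q Ψ ^ n) (R f) : D) : Lp ℝ 1 m)‖ := by
  simpa using h.summable_norm hB hΨ hmass hlam f 0

theorem tsum_norm_resolvent_le (hlam : 0 < lam) (f : Lp ℝ 1 m) :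
    ∑' n : ℕ, ‖(((greinerStep R B Q Ψ ^ n) (R f) : D) : Lp ℝ 1 m)‖ ≤ lam⁻¹ * ‖f‖ := by
  refine (h.summable_norm_resolvent hB hΨ hmass hlam f).tsum_le_of_sum_range_le fun N => ?_
  rw [← div_eq_inv_mul, le_div_iff₀' hlam]
  simpa using h.sum_norm_le hB hΨ hmass hlam.le f 0 N

/-- The series `∑ (R B + Q Ψ) ^ n R` converges strongly. -/
theorem exists_hasSum (hlam : 0 < lam) : ∃ T : Lp ℝ 1 m →L[ℝ] Lp ℝ 1 m,
    (∀ f, HasSum (fun n : ℕ => (((greinerStep R B Q Ψ ^ n) (R f) : D) : Lp ℝ 1 m)) (T f)) ∧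
    ∀ f, ‖T f‖ ≤ lam⁻¹ * ‖f‖ := by
  have hs := fun f => (h.summable_norm_resolvent hB hΨ hmass hlam f)
  have hsum := fun f => (hs f).of_norm.hasSum
  let T : Lp ℝ 1 m →ₗ[ℝ] Lp ℝ 1 m :=
    { toFun := fun f => ∑' n : ℕ, (((greinerStep R B Q Ψ ^ n) (R f) : D) : Lp ℝ 1 m)
      map_add' := fun f g => by
        refine (HasSum.tsum_eq ?_)
        simpa using (hsum f).add (hsum g)
      map_smul' := fun c f => by
        refine (HasSum.tsum_eq ?_)
        simpa using (hsum f).const_smul c }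
  have hT : ∀ f, ‖T f‖ ≤ lam⁻¹ * ‖f‖ := fun f =>
    (norm_tsum_le_tsum_norm (hs f)).trans (h.tsum_norm_resolvent_le hB hΨ hmass hlam f)
  exact ⟨T.mkContinuous lam⁻¹ hT, hsum, hT⟩

/-- Elements of `D` with `Ψ₀ f = Ψ f` are recovered from `(lam - A - B) f`. -/
theorem tendsto_sum_of_boundary_eq (hlam : 0 < lam) (f : D) (hf : Ψ₀ f = Ψ f) :
    Tendsto (fun N : ℕ => ∑ n ∈ Finset.range N, (((greinerStep R B Q Ψ ^ n)
      (R (lam • (f : Lp ℝ 1 m) - (A f + B f))) : D) : Lp ℝ 1 m)) atTop (𝓝 f) := by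
  set K := greinerStep R B Q Ψ with hK
  set k := lam • (f : Lp ℝ 1 m) - (A f + B f) with hk
  have hfix : f = R k + K f := by
    -- The condition `Ψ₀ f = Ψ f` turns the boundary term `Q (Ψ₀ f)` into a part of `K f`.
    have h1 := h.resolvent_add_lift f
    have h2 : lam • (f : Lp ℝ 1 m) - A f = k + B f := by rw [hk]; abel
    rw [h2, map_add, hf, add_assoc] at h1
    exact h1.symm
  have hiter : ∀ N : ℕ, ∑ n ∈ Finset.range N, (K ^ n) (R k) = f - (K ^ N) f := by
    intro N
    induction N with
    | zero => simp
    | succ N ih =>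
      have h4 : (K ^ N) f = (K ^ N) (R k) + (K ^ (N + 1)) f := by
        conv_lhs => rw [hfix]
        rw [map_add, pow_succ]
        rfl
      rw [Finset.sum_range_succ, ih, h4]
      abel
  -- Here `f` is R(λ - A)f + QΨ₀f, so the powers of `K` on it are summable by the bound with
  -- boundary datum.
  have hzero : Tendsto (fun N : ℕ => (((K ^ N) f : D) : Lp ℝ 1 m)) atTop (𝓝 0) := by
    have := (h.summable_norm hB hΨ hmass hlam (lam • (f : Lp ℝ 1 m) - A f)
      (Ψ₀ f)).of_norm.tendsto_atTop_zero
    rwa [h.resolvent_add_lift] at this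
  have hlim := hzero.const_sub (f : Lp ℝ 1 m)
  rw [sub_zero] at hlim
  refine hlim.congr fun N => ?_
  rw [← Submodule.coe_sum, hiter, Submodule.coe_sub]

end Bound

section ResolventIdentity

variable (h : IsGreinerResolvent A Ψ₀ lam R Q) (h' : IsGreinerResolvent A Ψ₀ mu R' Q')

include h h'

theorem resolvent_sub (f : Lp ℝ 1 m) : R f - R' f = (mu - lam) • R (R' f) := by
  have h1 := h.left_inv (R f - R' f) (by rw [map_sub, h.boundary, h'.boundary, sub_self])
  rw [← h1, ← map_smul]
  congr 1
  have h2 := h.sub_apply f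
  have h3 := h'.sub_apply f
  rw [sub_eq_iff_eq_add] at h2
  rw [sub_eq_iff_eq_add'] at h3
  rw [map_sub, Submodule.coe_sub, smul_sub, h2, sub_smul, h3]
  abel

/-- The difference of the two lifts has boundary value 0, so `R` recovers it from its image under
`lam - A`, which is (μ - λ)Q'Ψf. -/
theorem greinerStep_sub (hQ : ∀ g, Ψ₀ (Q g) = Ψ₀ (Q' g)) (f : D) :
    greinerStep R B Q Ψ f - greinerStep R' B Q' Ψ f
      = (mu - lam) • R (greinerStep R' B Q' Ψ f : D) := by
  simp only [greinerStep_apply]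
  have h1 := h.left_inv (Q (Ψ f) - Q' (Ψ f)) (by rw [map_sub, hQ, sub_self])
  have h2 := h.mem_ker (Ψ f)
  have h3 := h'.mem_ker (Ψ f)
  rw [sub_eq_zero] at h2 h3
  have h4 : Q (Ψ f) - Q' (Ψ f) = (mu - lam) • R (Q' (Ψ f) : D) := by
    rw [← h1, ← map_smul]
    congr 1
    rw [map_sub, Submodule.coe_sub, smul_sub, h2, sub_smul, h3]
    abel
  rw [add_sub_add_comm, h.resolvent_sub h', h4, Submodule.coe_add, map_add, smul_add]

/-- Induction on K^(n+1)R - K'^(n+1)R' = K(KⁿR - K'ⁿR') + (K - K')K'ⁿR'; the last summand is the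
antidiagonal term at (n + 1, 0). The right side is the n-th term of the Cauchy product of the two
series. -/
theorem pow_resolvent_sub (hQ : ∀ g, Ψ₀ (Q g) = Ψ₀ (Q' g)) (f : Lp ℝ 1 m) (n : ℕ) :
    (greinerStep R B Q Ψ ^ n) (R f) - (greinerStep R' B Q' Ψ ^ n) (R' f)
      = (mu - lam) • ∑ p ∈ Finset.HasAntidiagonal.antidiagonal n,
        (greinerStep R B Q Ψ ^ p.2) (R ((greinerStep R' B Q' Ψ ^ p.1) (R' f) : D)) := by
  induction n with
  | zero => simpa using h.resolvent_sub h' f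
  | succ n ih =>
    rw [Finset.Nat.sum_antidiagonal_succ', smul_add]
    simp only [end_pow_succ_apply, pow_zero, Module.End.one_apply]
    rw [← map_sum, ← map_smul (greinerStep R B Q Ψ), ← ih, ← h.greinerStep_sub h' hQ, map_sub]
    abel

end ResolventIdentity

end IsGreinerResolvent

end Greiner

end KatoGreiner

/-! ### The perturbed resolvent, and the data derived from A₀ and Ψ(λ). -/

namespace KatoGreiner

/-- Resummation of an absolutely convergent double series along antidiagonals. -/
theorem hasSum_antidiagonal {Z : Type*} [NormedAddCommGroup Z] [CompleteSpace Z]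
    {F : ℕ × ℕ → Z} {S : ℕ → Z} {s : Z} (hF : ∀ j, Summable fun i => ‖F (j, i)‖)
    (hF' : Summable fun j => ∑' i, ‖F (j, i)‖) (hS : ∀ j, HasSum (fun i => F (j, i)) (S j))
    (hs : HasSum S s) :
    HasSum (fun n => ∑ p ∈ Finset.HasAntidiagonal.antidiagonal n, F p) s := by
  have h1 : Summable fun p => ‖F p‖ :=
    (summable_prod_of_nonneg fun p => norm_nonneg (F p)).2 ⟨hF, hF'⟩
  have h2 := h1.of_norm.hasSum
  rw [(h2.prod_fiberwise hS).unique hs] at h2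
  rw [← Finset.HasAntidiagonal.sigmaAntidiagonalEquivProd.hasSum_iff] at h2
  refine h2.sigma fun n => ?_
  rw [← Finset.sum_finset_coe]
  exact hasSum_fintype _

section Perturbation

variable {E F : Type*} [MeasurableSpace E] [MeasurableSpace F]
  {m : Measure E} {μ : Measure F} {D : Submodule ℝ (Lp ℝ 1 m)}
  {A B : D →ₗ[ℝ] Lp ℝ 1 m} {Ψ₀ Ψ : D →ₗ[ℝ] Lp ℝ 1 μ}

namespace IsGreinerResolvent

variable (hB : IsPositiveOp B) (hΨ : IsPositiveOp Ψ)
  (hmass : ∀ f : D, 0 ≤ (f : Lp ℝ 1 m) → mass (A f + B f) + mass (Ψ f - Ψ₀ f) ≤ 0)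

include hB hΨ hmass

/-- The sums of the perturbation series satisfy the resolvent identity. -/
theorem resolvent_identity {lam mu : ℝ} (hlam : 0 < lam) (hmu : 0 < mu)
    {R R' : Lp ℝ 1 m →ₗ[ℝ] D} {Q Q' : Lp ℝ 1 μ →ₗ[ℝ] D} {T T' : Lp ℝ 1 m →L[ℝ] Lp ℝ 1 m}
    (h : IsGreinerResolvent A Ψ₀ lam R Q) (h' : IsGreinerResolvent A Ψ₀ mu R' Q')
    (hQ : ∀ g, Ψ₀ (Q g) = Ψ₀ (Q' g))
    (hT : ∀ f, HasSum (fun n : ℕ => (((greinerStep R B Q Ψ ^ n) (R f) : D) : Lp ℝ 1 m)) (T f))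
    (hT' : ∀ f, HasSum (fun n : ℕ => (((greinerStep R' B Q' Ψ ^ n) (R' f) : D) : Lp ℝ 1 m))
      (T' f)) (f : Lp ℝ 1 m) : T f - T' f = (mu - lam) • T (T' f) := by
  have hsum : ∀ v : ℕ → D, HasSum (fun j => (v j : Lp ℝ 1 m)) (T' f) →
      (Summable fun j => ‖(v j : Lp ℝ 1 m)‖) →
      HasSum (fun n => ∑ p ∈ Finset.HasAntidiagonal.antidiagonal n,
        (((greinerStep R B Q Ψ ^ p.2) (R (v p.1 : Lp ℝ 1 m)) : D) : Lp ℝ 1 m)) (T (T' f)) := by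
    intro v hv hv'
    exact hasSum_antidiagonal (F := fun p : ℕ × ℕ =>
        (((greinerStep R B Q Ψ ^ p.2) (R (v p.1 : Lp ℝ 1 m)) : D) : Lp ℝ 1 m))
      (fun j => h.summable_norm_resolvent hB hΨ hmass hlam (v j : Lp ℝ 1 m))
      (Summable.of_nonneg_of_le (fun j => tsum_nonneg fun i => norm_nonneg _)
        (fun j => h.tsum_norm_resolvent_le hB hΨ hmass hlam (v j : Lp ℝ 1 m)) (hv'.mul_left _))
      (fun j => hT (v j : Lp ℝ 1 m)) (hv.mapL T)
  refine ((hT f).sub (hT' f)).unique (((hsum _ (hT' f)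
    (h'.summable_norm_resolvent hB hΨ hmass hmu f)).const_smul (mu - lam)).congr_fun fun n => ?_)
  have e := congrArg (Subtype.val : D → Lp ℝ 1 m) (h.pow_resolvent_sub (B := B) (Ψ := Ψ) h' hQ f n)
  rw [Submodule.coe_sub, Submodule.coe_smul, Submodule.coe_sum] at e
  exact e

omit hmass in
-- As T f ≥ R f ≥ 0, the norm of λTf - λRf is the difference of the masses. Since λ∫Tf ≤ ∫f, this is
-- at most ∫(f - λRf).
theorem norm_smul_sub_le {lam : ℝ} (hlam : 0 < lam) {R : Lp ℝ 1 m →ₗ[ℝ] D}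
    {Q : Lp ℝ 1 μ →ₗ[ℝ] D} {T : Lp ℝ 1 m →L[ℝ] Lp ℝ 1 m} (h : IsGreinerResolvent A Ψ₀ lam R Q)
    (hT : ∀ f, HasSum (fun n : ℕ => (((greinerStep R B Q Ψ ^ n) (R f) : D) : Lp ℝ 1 m)) (T f))
    (hTn : ∀ f, ‖T f‖ ≤ lam⁻¹ * ‖f‖) {f : Lp ℝ 1 m} (hf : 0 ≤ f) :
    ‖lam • T f - f‖ ≤ 2 * ‖lam • (R f : Lp ℝ 1 m) - f‖ := by
  have hpos := fun n => h.pow_nonneg hB hΨ (h.nonneg f hf) n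
  have hle : (R f : Lp ℝ 1 m) ≤ T f := by
    simpa using le_hasSum (hT f) 0 fun n _ => hpos n
  have hT0 : 0 ≤ T f := (h.nonneg f hf).trans hle
  have h1 : ‖lam • T f - lam • (R f : Lp ℝ 1 m)‖ ≤ ‖lam • (R f : Lp ℝ 1 m) - f‖ := by
    have h2 : lam * mass (T f) ≤ mass f := by
      rw [mass_eq_norm hT0, mass_eq_norm hf, ← le_inv_mul_iff₀ hlam]
      exact hTn f
    rw [← smul_sub, ← mass_eq_norm (Lp_smul_nonneg hlam.le (sub_nonneg.2 hle)), smul_sub, mass_sub,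
      mass_smul, norm_sub_rev]
    refine le_trans ?_ (mass_le_norm _)
    rw [mass_sub]
    linarith
  have e : lam • T f - f
      = (lam • T f - lam • (R f : Lp ℝ 1 m)) + (lam • (R f : Lp ℝ 1 m) - f) := by abel
  rw [e]
  refine (norm_add_le _ _).trans ?_
  linarith

/-- The sums of the perturbation series form a positive contractive resolvent. -/
theorem exists_isContractiveResolvent {R : ℝ → Lp ℝ 1 m →ₗ[ℝ] D} {Q : ℝ → Lp ℝ 1 μ →ₗ[ℝ] D}
    (h : ∀ lam : ℝ, 0 < lam → IsGreinerResolvent A Ψ₀ lam (R lam) (Q lam))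
    (hQ : ∀ lam mu : ℝ, 0 < lam → 0 < mu → ∀ g, Ψ₀ (Q lam g) = Ψ₀ (Q mu g))
    (hlim : ∀ f, Tendsto (fun lam : ℝ => lam • (R lam f : Lp ℝ 1 m)) atTop (𝓝 f)) :
    ∃ T : ℝ → Lp ℝ 1 m →L[ℝ] Lp ℝ 1 m, IsContractiveResolvent T ∧
      (∀ lam : ℝ, 0 < lam → ∀ f, HasSum
        (fun n : ℕ => (((greinerStep (R lam) B (Q lam) Ψ ^ n) (R lam f) : D) : Lp ℝ 1 m))
        (T lam f)) ∧
      ∀ lam : ℝ, 0 < lam → ∀ f, 0 ≤ f → 0 ≤ T lam f := by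
  have hex : ∀ lam : ℝ, ∃ T : Lp ℝ 1 m →L[ℝ] Lp ℝ 1 m, 0 < lam → (∀ f, HasSum
      (fun n : ℕ => (((greinerStep (R lam) B (Q lam) Ψ ^ n) (R lam f) : D) : Lp ℝ 1 m)) (T f)) ∧
      ∀ f, ‖T f‖ ≤ lam⁻¹ * ‖f‖ := by
    intro lam
    by_cases hlam : 0 < lam
    · obtain ⟨T, hT⟩ := (h lam hlam).exists_hasSum hB hΨ hmass hlam
      exact ⟨T, fun _ => hT⟩
    · exact ⟨0, fun h => absurd h hlam⟩
  choose T hT using hex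
  have hnonneg : ∀ f, 0 ≤ f → Tendsto (fun lam : ℝ => lam • T lam f) atTop (𝓝 f) := by
    intro f hf
    rw [tendsto_iff_norm_sub_tendsto_zero]
    have h0 : Tendsto (fun lam : ℝ => 2 * ‖lam • (R lam f : Lp ℝ 1 m) - f‖) atTop (𝓝 0) := by
      simpa using (tendsto_iff_norm_sub_tendsto_zero.1 (hlim f)).const_mul 2
    refine squeeze_zero' (Eventually.of_forall fun _ => norm_nonneg _) ?_ h0
    filter_upwards [eventually_gt_atTop (0 : ℝ)] with lam hlam
    exact (h lam hlam).norm_smul_sub_le hB hΨ hlam (hT lam hlam).1 (hT lam hlam).2 hf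
  refine ⟨T, ⟨fun lam mu hlam hmu f => ?_, fun lam hlam f => ?_, fun f => ?_⟩,
    fun lam hlam => (hT lam hlam).1, fun lam hlam f hf => ?_⟩
  · exact resolvent_identity hB hΨ hmass hlam hmu (h lam hlam) (h mu hmu) (hQ lam mu hlam hmu)
      (hT lam hlam).1 (hT mu hmu).1 f
  · rw [← le_inv_mul_iff₀ hlam]
    exact (hT lam hlam).2 f
  -- The domination argument needs `0 ≤ f`; the general case follows by linearity.
  · have h1 := (hnonneg f⁺ (posPart_nonneg f)).sub (hnonneg f⁻ (negPart_nonneg f))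
    simpa only [← smul_sub, ← map_sub, posPart_sub_negPart] using h1
  · exact ((hT lam hlam).1 f).nonneg fun n =>
      (h lam hlam).pow_nonneg hB hΨ ((h lam hlam).nonneg f hf) n

end IsGreinerResolvent

/-- The generator of a contraction semigroup has the Laplace transform as its resolvent. -/
theorem IsContractionSemigroup.exists_isResolventAt {X : Type*} [NormedAddCommGroup X]
    [NormedSpace ℝ X] [CompleteSpace X] {S : ℝ → X →L[ℝ] X} (hS : IsContractionSemigroup S)
    {G : X →ₗ.[ℝ] X} (hG : IsGenerator S G) {lam : ℝ} (hlam : 0 < lam) :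
    ∃ R : X →ₗ[ℝ] G.domain, IsResolventAt G lam R ∧ ∀ f, (R f : X) = laplace S lam f := by
  let L : X →ₗ[ℝ] X :=
    { toFun := laplace S lam
      map_add' := hS.laplace_add hlam
      map_smul' := laplace_smul lam }
  have hL : ∀ f, L f ∈ G.domain := fun f => (hG.1 _).2 ⟨_, hS.tendsto_laplace hlam f⟩
  have hres : ∀ f, lam • (L f) - G ⟨L f, hL f⟩ = f := fun f => by
    rw [tendsto_nhds_unique (hG.2 ⟨L f, hL f⟩) (hS.tendsto_laplace hlam f)]
    exact sub_sub_cancel _ _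
  refine ⟨L.codRestrict G.domain hL, ⟨hres, fun f => ?_, ?_⟩, fun f => rfl⟩
  · set R := L.codRestrict G.domain hL with hR
    set d := R (lam • (f : X) - G f) - f with hd
    have h1 : lam • (d : X) - G d = 0 := by
      have h2 : lam • (R (lam • (f : X) - G f) : X) - G (R (lam • (f : X) - G f))
        = lam • (f : X) - G f := hres _
      rw [hd, LinearPMap.map_sub, Submodule.coe_sub, smul_sub, sub_sub_sub_comm, h2, sub_self]
    have h3 := hG.2 d
    rw [← sub_eq_zero.1 h1] at h3
    exact sub_eq_zero.1 (Subtype.ext (hS.eq_zero_of_tendsto hlam h3))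
  · exact (L.mkContinuous lam⁻¹ (hS.norm_laplace_le hlam)).continuous

theorem mem_restrictDomain_domain {X : Type*} [NormedAddCommGroup X] [NormedSpace ℝ X]
    {D : Submodule ℝ X} (A : D →ₗ[ℝ] X) (S : Submodule ℝ D) (f : D) :
    (f : X) ∈ (restrictDomain A S).domain ↔ f ∈ S := by
  constructor
  · rintro ⟨⟨g, hg, hgf⟩, -⟩
    rwa [← Subtype.ext hgf]
  · exact fun hf => ⟨⟨f, hf, rfl⟩, f.2⟩

/-- Both cases fit one structure: `Q` inverts `Ψ₀` only on the range of `Ψ₀`, and boundary mass is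
only required not to increase, which also holds when `Ψ₀` and `Q` vanish. -/
theorem isGreinerResolvent_of_isResolventAt {lam : ℝ}
    {R₀ : Lp ℝ 1 m →ₗ[ℝ] (restrictDomain A (LinearMap.ker Ψ₀)).domain}
    (hR : IsResolventAt (restrictDomain A (LinearMap.ker Ψ₀)) lam R₀)
    (hpos : ∀ f, 0 ≤ f → 0 ≤ (R₀ f : Lp ℝ 1 m)) {Q : Lp ℝ 1 μ →ₗ[ℝ] D}
    (hQ : Ψ₀ ≠ 0 → IsPositiveRightInverse A Ψ₀ lam Q) (hQ₀ : Ψ₀ = 0 → Q = 0) :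
    IsGreinerResolvent A Ψ₀ lam
      (Submodule.inclusion (restrictDomain_domain_le A (LinearMap.ker Ψ₀)) ∘ₗ R₀) Q where
  sub_apply := hR.1
  boundary f := (mem_restrictDomain_domain A (LinearMap.ker Ψ₀) (Submodule.inclusion
    (restrictDomain_domain_le A (LinearMap.ker Ψ₀)) (R₀ f))).1 (R₀ f).2
  nonneg := hpos
  left_inv f hf := by
    have h := hR.2.1 ⟨f, (mem_restrictDomain_domain A (LinearMap.ker Ψ₀) f).2 hf⟩
    exact congrArg (Submodule.inclusion (restrictDomain_domain_le A (LinearMap.ker Ψ₀))) h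
  mem_ker g := by
    by_cases h : Ψ₀ = 0
    · simp [hQ₀ h]
    · exact (hQ h).mem_ker g
  lift_nonneg g hg := by
    by_cases h : Ψ₀ = 0
    · simp [hQ₀ h]
    · exact (hQ h).positive g hg
  boundary_lift f := by
    by_cases h : Ψ₀ = 0
    · simp [h]
    · exact (hQ h).right_inv _
  mass_boundary_lift g hg := by
    by_cases h : Ψ₀ = 0
    · rw [h, LinearMap.zero_apply, mass_zero]
      exact mass_nonneg hg
    · rw [(hQ h).right_inv]

end Perturbation

end KatoGreiner

/-! ### The generation theorem. -/

open KatoGreiner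

theorem theorem3p1 {E F : Type*} [MeasurableSpace E] [MeasurableSpace F]
    (m : Measure E) [SigmaFinite m] (μ : Measure F) [SigmaFinite μ]
    (D : Submodule ℝ (Lp ℝ 1 m))
    (A B : D →ₗ[ℝ] Lp ℝ 1 m) (Ψ₀ Ψ : D →ₗ[ℝ] Lp ℝ 1 μ)
    (hB : KatoGreiner.IsPositiveOp B)
    (hΨ₀ : KatoGreiner.IsPositiveOp Ψ₀) (hΨ : KatoGreiner.IsPositiveOp Ψ)
    -- the restriction of `A` to the kernel of `Ψ₀` generates a substochastic semigroup
    (hA₀ : ∃ S : ℝ → Lp ℝ 1 m →L[ℝ] Lp ℝ 1 m, KatoGreiner.IsSubstochasticSemigroup S ∧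
      KatoGreiner.IsGenerator S (KatoGreiner.restrictDomain A (LinearMap.ker Ψ₀)))
    -- the positive right inverses `Q lam`; the term with `Q lam` is absent if `Ψ₀ = 0`
    (Q : ℝ → Lp ℝ 1 μ →ₗ[ℝ] D)
    (hQ : Ψ₀ ≠ 0 → ∀ lam : ℝ, 0 < lam → KatoGreiner.IsPositiveRightInverse A Ψ₀ lam (Q lam))
    (hQ₀ : Ψ₀ = 0 → ∀ lam : ℝ, 0 < lam → Q lam = 0)
    (hmass : ∀ f : D, 0 ≤ (f : Lp ℝ 1 m) →
      ∫ x, (A f + B f : Lp ℝ 1 m) x ∂m + ∫ y, (Ψ f - Ψ₀ f : Lp ℝ 1 μ) y ∂μ ≤ 0) :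
    ∃ (P : ℝ → Lp ℝ 1 m →L[ℝ] Lp ℝ 1 m) (G : Lp ℝ 1 m →ₗ.[ℝ] Lp ℝ 1 m),
      KatoGreiner.IsSubstochasticSemigroup P ∧ KatoGreiner.IsGenerator P G ∧
      -- `G` extends `A + B` on the domain where `Ψ₀ f = Ψ f`
      KatoGreiner.restrictDomain (A + B) (LinearMap.eqLocus Ψ₀ Ψ) ≤ G ∧
      ∀ lam : ℝ, 0 < lam →
        ∃ (R₀ : Lp ℝ 1 m →ₗ[ℝ] (KatoGreiner.restrictDomain A (LinearMap.ker Ψ₀)).domain)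
          (R : Lp ℝ 1 m →ₗ[ℝ] G.domain),
          KatoGreiner.IsResolventAt (KatoGreiner.restrictDomain A (LinearMap.ker Ψ₀)) lam R₀ ∧
          KatoGreiner.IsResolventAt G lam R ∧
          ∀ f : Lp ℝ 1 m,
            Tendsto (fun N : ℕ => ∑ n ∈ Finset.range (N + 1),
              (((KatoGreiner.stepOperator
                  (KatoGreiner.restrictDomain_domain_le A (LinearMap.ker Ψ₀))
                  R₀ B (Q lam) Ψ ^ n)
                (Submodule.inclusion
                  (KatoGreiner.restrictDomain_domain_le A (LinearMap.ker Ψ₀)) (R₀ f)) : D) :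
                Lp ℝ 1 m))
              atTop (𝓝 (R f : Lp ℝ 1 m)) := by
  have hmass' : ∀ f : D, 0 ≤ (f : Lp ℝ 1 m) → mass (A f + B f) + mass (Ψ f - Ψ₀ f) ≤ 0 := hmass
  obtain ⟨S, hS, hSG⟩ := hA₀
  have hSc := hS.isContractionSemigroup
  set A₀ := restrictDomain A (LinearMap.ker Ψ₀) with hA₀
  have hex : ∀ lam : ℝ, ∃ R₀ : Lp ℝ 1 m →ₗ[ℝ] A₀.domain, 0 < lam → IsResolventAt A₀ lam R₀ ∧
      ∀ f, (R₀ f : Lp ℝ 1 m) = IsContractionSemigroup.laplace S lam f := by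
    intro lam
    by_cases hlam : 0 < lam
    · obtain ⟨R₀, h⟩ := hSc.exists_isResolventAt hSG hlam
      exact ⟨R₀, fun _ => h⟩
    · exact ⟨0, fun h => absurd h hlam⟩
  choose R₀ hR₀ using hex
  have hgr : ∀ lam : ℝ, 0 < lam → IsGreinerResolvent A Ψ₀ lam (Submodule.inclusion
      (restrictDomain_domain_le A (LinearMap.ker Ψ₀)) ∘ₗ R₀ lam) (Q lam) := fun lam hlam =>
    isGreinerResolvent_of_isResolventAt (hR₀ lam hlam).1
      (fun f hf => by rw [(hR₀ lam hlam).2]; exact laplace_nonneg hS lam hf)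
      (fun h => hQ h lam hlam) (fun h => hQ₀ h lam hlam)
  have hQQ : ∀ lam mu : ℝ, 0 < lam → 0 < mu → ∀ g, Ψ₀ (Q lam g) = Ψ₀ (Q mu g) := by
    intro lam mu hlam hmu g
    by_cases h : Ψ₀ = 0
    · simp [h]
    · rw [(hQ h lam hlam).right_inv, (hQ h mu hmu).right_inv]
  obtain ⟨T, hT, hTsum, hTpos⟩ :=
    IsGreinerResolvent.exists_isContractiveResolvent hB hΨ hmass' hgr hQQ fun f => by
      refine (hSc.tendsto_smul_laplace f).congr' ?_
      filter_upwards [eventually_gt_atTop (0 : ℝ)] with lam hlam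
      exact congrArg (lam • ·) ((hR₀ lam hlam).2 f).symm
  obtain ⟨P, G, hP, hPG, hcone, hmem, hres⟩ := hT.exists_generator
  refine ⟨P, G, ⟨hP.zero, hP.add, hP.continuousOn, ?_, fun t ht f _ => hP.norm_le t ht f⟩, hPG,
    ?_, fun lam hlam => ?_⟩
  -- Positivity of the semigroup is invariance of the closed cone of nonnegative elements.
  · exact hcone (Set.Ici 0) isClosed_Ici Set.self_mem_Ici
      (fun f hf g hg => Set.mem_Ici.2 (add_nonneg (Set.mem_Ici.1 hf) (Set.mem_Ici.1 hg)))
      (fun c hc f hf => Lp_smul_nonneg hc hf) hTpos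
  · have key : ∀ f : D, Ψ₀ f = Ψ f →
        ∃ h : (f : Lp ℝ 1 m) ∈ G.domain, G ⟨f, h⟩ = A f + B f := by
      intro f hf
      -- One value of λ suffices: f = T(1)(f - Af - Bf) already determines the value of `G` at `f`.
      refine hmem 1 one_pos f (A f + B f) ?_
      exact tendsto_nhds_unique
        ((hgr 1 one_pos).tendsto_sum_of_boundary_eq hB hΨ hmass' one_pos f hf)
        (hTsum 1 one_pos _).tendsto_sum_nat
    have hbd : ∀ f : (restrictDomain (A + B) (LinearMap.eqLocus Ψ₀ Ψ)).domain,
        Ψ₀ (Submodule.inclusion (restrictDomain_domain_le _ _) f)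
          = Ψ (Submodule.inclusion (restrictDomain_domain_le _ _) f) := fun f =>
      (mem_restrictDomain_domain (A + B) (LinearMap.eqLocus Ψ₀ Ψ)
        (Submodule.inclusion (restrictDomain_domain_le _ _) f)).1 f.2
    refine ⟨fun f hf => (key _ (hbd ⟨f, hf⟩)).1, fun x y hxy => ?_⟩
    obtain ⟨h, hx⟩ := key _ (hbd x)
    have hy : y = ⟨x, h⟩ := Subtype.ext hxy.symm
    rw [hy]
    exact hx.symm
  · obtain ⟨R, hR, hRT⟩ := hres lam hlam
    refine ⟨R₀ lam, R, (hR₀ lam hlam).1, hR, fun f => ?_⟩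
    rw [hRT]
    -- `stepOperator` unfolds to `greinerStep` with the inclusion absorbed in `R`; the shift by one
    -- makes the sum run over n ≤ N.
    exact (hTsum lam hlam f).tendsto_sum_nat.comp (tendsto_add_atTop_nat 1)
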